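/- Write $q=e^{2\pi i\tau}$ with $\tau$ in the upper half-plane, and let $T_n=n(n+1)/2$ for $n\ge 0$, $\Psi(\tau)=\sum_{n\ge 0}q^{T_n}$ and $\mathcal F(\tau)=\sum_{m,n\in\mathbb Z}q^{m^2+mn+n^2}$. Let $u,k\ge 0$ be integers with $k$ even, let $a_1,\dots,a_u$ and $c_1,\dots,c_k$ be positive integers, and suppose that $h:=c_1+\cdots+c_k$ is divisible by $8$. For $n\ge 0$ let $N(n)$ be the number of pairs $(x,z)\in\mathbb Z^{2u}\times\mathbb Z_{\ge 0}^{k}$ with $$\sum_{i=1}^u a_i\,(x_{2i-1}^2+x_{2i-1}x_{2i}+x_{2i}^2)+\sum_{j=1}^k c_j\,T_{z_j}=n,$$ and let $\psi_{l,t}(\tau)=\sum_{n\ge 0}N(n)q^n$ be the generating function of this mixed form. Then the series converges for every $\tau$ and $$\psi_{l,t}(\tau)=\prod_{i=1}^u\mathcal F(a_i\tau)\prod_{j=1}^k\Psi(c_j\tau),$$ and $q^{h/8}\psi_{l,t}(\tau)$ belongs to $M_{u+k/2}(\Gamma_0(L),\chi')$, the space of holomorphic modular forms (holomorphic also at all cusps)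 of weight $u+k/2$ on $\Gamma_0(L)$ with character $\chi'$, where $$L=\mathrm{lcm}\bigl[\,3\,\mathrm{lcm}(a_1,\dots,a_u),\;2\,\mathrm{lcm}(c_1,\dots,c_k)\bigr]$$ (an empty lcm being $1$), and $\chi'$ is the Dirichlet character modulo $L$ whose value at each integer $d$ coprime to $L$ is $\chi(d)$ if $u$ is even and $\left(\frac{d}{3}\right)\chi(d)$ if $u$ is odd. Here $\chi(d)=\left(\frac{(-1)^{k/2}\,4\,c_1c_2\cdots c_k}{d}\right)$ is the Kronecker symbol and $\left(\frac{d}{3}\right)$ is the Legendre symbol. (That these values define a Dirichlet character modulo $L$ is part of the claim.) -/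

import Mathlib

open scoped MatrixGroups ModularForm

noncomputable section

namespace MixedForm

/-- The Kronecker symbol `(D / n)`, for all integers `D` and `n`: completely multiplicative in the
lower argument, equal to the Legendre symbol at odd primes, with `(D / -1)` the sign of `D`
(`1` for `D ≥ 0`), `(D / 2)` equal to `0`, `1`, `-1` for `D` even, `D ≡ ±1 mod 8`, `D ≡ ±3 mod 8`,
and `(D / 0) = 1` if `D = ±1` and `0` otherwise. -/
def kroneckerSym (D n : ℤ) : ℤ :=
  if n = 0 then (if D.natAbs = 1 then 1 else 0)
  else (if n < 0 ∧ D < 0 then -1 else 1) * ZMod.χ₈ (D : ZMod 8) ^ padicValNat 2 n.natAbs *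
    jacobiSym D (n.natAbs / 2 ^ padicValNat 2 n.natAbs)

/-- The space `M_w(Γ₀(N), χ)` of holomorphic modular forms of weight `w`, level `N` and
character `χ`: holomorphic functions on the upper half-plane, bounded at all cusps, such that
`f(γ τ) = χ(d) (c τ + d)^w f(τ)` for every `γ = (a, b; c, d)` in `Γ₀(N)`. Such functions are
invariant under `Γ₁(N)`, and the cusps of `Γ₁(N)` are all of `ℚ ∪ {∞}`. -/
def modularFormsWithChar (N : ℕ) (w : ℤ) (χ : DirichletCharacter ℂ N) :
    Submodule ℂ (ModularForm ((CongruenceSubgroup.Gamma1 N).map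
      (Matrix.SpecialLinearGroup.mapGL ℝ)) w) where
  carrier := {f | ∀ γ ∈ CongruenceSubgroup.Gamma0 N,
    (⇑f : UpperHalfPlane → ℂ) ∣[w] γ = χ ((γ 1 1 : ℤ) : ZMod N) • (⇑f : UpperHalfPlane → ℂ)}
  add_mem' := by
    intro f g hf hg γ hγ
    rw [FunLike.coe_add, SlashAction.add_slash, hf γ hγ, hg γ hγ, smul_add]
  zero_mem' := by
    intro γ _
    rw [FunLike.coe_zero, SlashAction.zero_slash, smul_zero]
  smul_mem' := by
    intro r f hf γ hγ
    rw [FunLike.coe_smul, ModularForm.SL_smul_slash, hf γ hγ, smul_comm]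

/-- `𝓕(z) = ∑_{m, n ∈ ℤ} q^(m² + m n + n²)`, where `q = e^(2 π i z)`. -/
def calF (z : ℂ) : ℂ :=
  ∑' p : ℤ × ℤ, Complex.exp (2 * Real.pi * Complex.I * z *
    ((p.1 ^ 2 + p.1 * p.2 + p.2 ^ 2 : ℤ) : ℂ))

/-- The triangular number `T_n = n (n + 1) / 2` (the division is exact). -/
def triangular (n : ℕ) : ℕ := n * (n + 1) / 2

/-- `Ψ(z) = ∑_{n ≥ 0} q^(T_n)`, where `q = e^(2 π i z)`. -/
def Psi (z : ℂ) : ℂ :=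
  ∑' n : ℕ, Complex.exp (2 * Real.pi * Complex.I * z * (triangular n : ℂ))

/-- The mixed form `∑ᵢ aᵢ (x_{2i-1}² + x_{2i-1} x_{2i} + x_{2i}²) + ∑ⱼ cⱼ T_{zⱼ}`; the pair
`(x_{2i-1}, x_{2i})` is `x i`. -/
def mixedForm {u k : ℕ} (a : Fin u → ℕ) (c : Fin k → ℕ) (x : Fin u → ℤ × ℤ) (z : Fin k → ℕ) : ℤ :=
  ∑ i, (a i : ℤ) * ((x i).1 ^ 2 + (x i).1 * (x i).2 + (x i).2 ^ 2) +
    ∑ j, (c j : ℤ) * (triangular (z j) : ℤ)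

/-- The number of representations of `n` by the mixed form, with `x ∈ ℤ^(2u)`, `z ∈ ℕ₀^k`. -/
def repNum {u k : ℕ} (a : Fin u → ℕ) (c : Fin k → ℕ) (n : ℕ) : ℕ :=
  {p : (Fin u → ℤ × ℤ) × (Fin k → ℕ) | mixedForm a c p.1 p.2 = (n : ℤ)}.ncard

/-- The generating function `∑_{n ≥ 0} N(n) q^n` of the mixed form, `N(n)` being the number of
representations of `n` and `q = e^(2 π i τ)`. -/
def psiLT {u k : ℕ} (a : Fin u → ℕ) (c : Fin k → ℕ) (τ : ℂ) : ℂ :=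
  ∑' n : ℕ, (repNum a c n : ℂ) * Complex.exp (2 * Real.pi * Complex.I * τ) ^ n

/-- The level `lcm [3 lcm(a₁, …, a_u), 2 lcm(c₁, …, c_k)]` (an empty `lcm` is `1`). -/
def level {u k : ℕ} (a : Fin u → ℕ) (c : Fin k → ℕ) : ℕ :=
  Nat.lcm (3 * Finset.univ.lcm a) (2 * Finset.univ.lcm c)

end MixedForm

end

/-! Grouping the terms of the absolutely convergent product of the series for `calF` and `Psi` by
exponent gives the generating function. Moreover $2q^{1/8}\Psi(\tau)$ is the theta constant
`theta2`, so $q^{h/8}\psi_{l,t}$ is the product `mixedTheta` of the $\mathcal F(a_i\tau)$ and the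
$\theta_2(c_j\tau)/2$. It remains to find how each factor transforms.

`theta2` is an eigenfunction under $\Gamma_0(2)$, with multiplier $\left(\frac{c}{d}\right)e^{2\pi
i(bd+d-1)/8}$ for $d>0$ (`theta2_transform`), and `calF` under $\Gamma_0(3)$, with character
$\left(\frac{d}{3}\right)$ (`calF_transform`). Both laws come from Euclidean descent on the lower
row, using the translation by 1 and the lower triangular matrices with lower left entry $\pm2$ or
$\pm3$. Conjugation by $\operatorname{diag}(m,1)$ passes to $m\tau$ and explains the level $L$. In
the product, $8\mid h$ kills the dependence on $b$ and $k$ even turns the Jacobi symbols into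
$\chi(d)$ (`prod_theta2Mult`).

That the values of $\chi'$ depend only on $d$ modulo $L$ is read off from the function itself: it
does not vanish at $i$, so its multiplier is determined by the matrix (`mixedChar_add_level`).

For the cusps, the fourth power of $|\theta_2|+|\theta_3|+|\theta_4|$ times $\operatorname{Im}\tau$
is invariant under the whole of $SL_2(\mathbb Z)$, which bounds every factor at every cusp
(`thetaSum_isBigO`). -/

noncomputable section

namespace MixedForm

open Complex
open Real (pi)

/-! ### Jacobi symbols under a shift of the lower argument -/

section Jacobi

open scoped NumberTheorySymbols

/-- After reciprocity the shift is invisible modulo $m$; only the sign changes, by $(-1)^{(m/2)m}$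
with $m$ odd (integer division), which is $\chi_4(m)$. -/
theorem jacobiSym_add_two_mul_nat {m d : ℕ} (hm : Odd m) (hd : Odd d) :
    J((m : ℤ) | d + 2 * m) = ZMod.χ₄ m * J((m : ℤ) | d) := by
  have hd' : Odd (d + 2 * m) := hd.add_even (even_two_mul m)
  rw [jacobiSym.quadratic_reciprocity hm hd, jacobiSym.quadratic_reciprocity hm hd',
    ZMod.χ₄_eq_neg_one_pow (Nat.odd_iff.mp hm)]
  have h1 : J(((d + 2 * m : ℕ) : ℤ) | m) = J((d : ℤ) | m) := by
    apply jacobiSym.mod_left'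
    push_cast
    simp
  have h2 : (d + 2 * m) / 2 = d / 2 + m := by omega
  have h3 : ((-1 : ℤ) ^ (m / 2)) ^ m = (-1) ^ (m / 2) := by
    rcases neg_one_pow_eq_or ℤ (m / 2) with h | h <;> simp [h, hm.neg_one_pow]
  rw [h1, h2, mul_add, pow_add, pow_mul (-1) (m / 2) m, h3]
  ring

/-- For negative $e=-m$ the roles of $d$ and $d'$ are exchanged, and the factors
$\left(\frac{-1}{\cdot}\right)=\chi_4$ leave an identity modulo 4. -/
theorem jacobiSym_add_two_mul {e : ℤ} {d d' : ℕ} (he : Odd e) (hd : Odd d)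
    (h : (d' : ℤ) = d + 2 * e) : J(e | d') = ZMod.χ₄ (e : ZMod 4) * J(e | d) := by
  obtain ⟨m, rfl | rfl⟩ := Int.eq_nat_or_neg e
  · obtain rfl : d' = d + 2 * m := by omega
    simpa using jacobiSym_add_two_mul_nat (by simpa using he) hd
  · have hm : Odd m := by simpa using he
    obtain rfl : d = d' + 2 * m := by omega
    have hd' : Odd d' := by
      rw [Nat.odd_iff] at hd ⊢; omega
    rw [jacobiSym.neg _ hd, jacobiSym.neg _ hd', jacobiSym_add_two_mul_nat hm hd']
    have key : ZMod.χ₄ (d' : ZMod 4) = ZMod.χ₄ ((-(m : ℤ) : ℤ) : ZMod 4) *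
        ZMod.χ₄ ((d' + 2 * m : ℕ) : ZMod 4) * ZMod.χ₄ (m : ZMod 4) := by
      have hx : (d' : ZMod 4) = 1 ∨ (d' : ZMod 4) = 3 := by
        rcases (by rw [Nat.odd_iff] at hd'; omega : d' % 4 = 1 ∨ d' % 4 = 3) with h | h
        · left; simpa using (ZMod.natCast_eq_natCast_iff' d' 1 4).2 h
        · right; simpa using (ZMod.natCast_eq_natCast_iff' d' 3 4).2 h
      have hy : (m : ZMod 4) = 1 ∨ (m : ZMod 4) = 3 := by
        rcases (by rw [Nat.odd_iff] at hm; omega : m % 4 = 1 ∨ m % 4 = 3) with h | h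
        · left; simpa using (ZMod.natCast_eq_natCast_iff' m 1 4).2 h
        · right; simpa using (ZMod.natCast_eq_natCast_iff' m 3 4).2 h
      push_cast
      rcases hx with hx | hx <;> rcases hy with hy | hy <;> rw [hx, hy] <;> decide
    rw [key]
    ring

/-- The Jacobi symbol `(c / d)`, `c` even, under `d ↦ d + c`. -/
theorem jacobiSym_add_self {a b c : ℤ} {d d' : ℕ} (hdet : a * d - b * c = 1) (hc : 2 ∣ c)
    (h : (d' : ℤ) = d + c) :
    ∃ m : ℤ, c * (2 * b + a + 1) = 4 * m ∧ J(c | d) = J(c | d') * (if Even m then 1 else -1) := by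
  obtain ⟨e, rfl⟩ := hc
  have hdet2 : a * d - 2 * (b * e) = 1 := by linarith [hdet]
  have had : Odd (a * d) := ⟨b * e, by linarith⟩
  obtain ⟨ha, hd⟩ := Int.odd_mul.1 had
  have hd : Odd d := by simpa using hd
  have hd' : Odd d' := by
    have : Odd (d' : ℤ) := by
      rw [h]; exact (by simpa using hd : Odd (d : ℤ)).add_even (even_two_mul e)
    simpa using this
  obtain ⟨r, hr⟩ := ha
  -- If $4\mid c$, the symbol of $c$ is that of $c/4$, whose period divides $c$, so there is no
  -- sign. Otherwise $c=2e$ with $e$ odd, and the sign comes from $\chi_8$ and $\chi_4$.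
  rcases Int.even_or_odd e with ⟨f, hf⟩ | he
  · refine ⟨2 * f * (b + r + 1), by subst hf hr; ring, ?_⟩
    rw [if_pos ⟨f * (b + r + 1), by ring⟩, mul_one]
    have h4 : (2 * e) % 4 = 0 := by omega
    rw [← jacobiSym.div_four_left h4 (Nat.odd_iff.mp hd),
      ← jacobiSym.div_four_left h4 (Nat.odd_iff.mp hd'),
      jacobiSym.mod_right _ hd, jacobiSym.mod_right _ hd']
    congr 1
    have h5 : 2 * e / 4 = f := by omega
    zify
    rw [h5, h]
    refine Int.modEq_iff_dvd.2 ?_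
    rw [show (d : ℤ) + 2 * e - d = 4 * f by omega]
    exact mul_dvd_mul_left _ ((abs_dvd _ _).2 dvd_rfl)
  · refine ⟨e * (b + r + 1), by subst hr; ring, ?_⟩
    rw [jacobiSym.mul_left, jacobiSym.mul_left, jacobiSym.at_two hd, jacobiSym.at_two hd',
      jacobiSym_add_two_mul he hd h]
    suffices hs : ZMod.χ₈ (d : ZMod 8) = ZMod.χ₈ (d' : ZMod 8) * ZMod.χ₄ (e : ZMod 4) *
        (if Even (e * (b + r + 1)) then 1 else -1) by
      rw [hs]; ring
    -- The determinant gives $be=rd+s$ with $d=2s+1$. As $d$ and $e$ are odd, the parity then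
    -- depends on $(d-1)/2$ alone, and a check modulo 8 remains.
    have hev : Even (e * (b + r + 1)) ↔ Even (r * d + r * e + (d - 1) / 2 + e) := by
      obtain ⟨s, hs⟩ := hd
      have : b * e = r * d + s := by
        have h1 : (d : ℤ) = 2 * s + 1 := by exact_mod_cast hs
        rw [hr, h1] at hdet2
        rw [h1]
        linarith
      have h2 : ((d : ℤ) - 1) / 2 = s := by omega
      rw [h2]
      rw [show e * (b + r + 1) = r * d + r * e + s + e by linear_combination this]
    have he2 : ¬ Even e := Int.not_even_iff_odd.2 he
    have hd2 : Odd (d : ℤ) := by simpa using hd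
    have hev2 : Even (e * (b + r + 1)) ↔ ¬ Even (((d : ℤ) - 1) / 2) := by
      rw [hev, Int.even_add, Int.even_add, Int.even_add, Int.even_mul, Int.even_mul]
      have : ¬ Even (d : ℤ) := Int.not_even_iff_odd.2 hd2
      tauto
    have hc8 : ZMod.χ₈ (d : ZMod 8) = ZMod.χ₈ ((d : ℤ) : ZMod 8) := by simp
    have hc8' : ZMod.χ₈ (d' : ZMod 8) = ZMod.χ₈ ((d' : ℤ) : ZMod 8) := by simp
    rw [hc8, hc8', ZMod.χ₈_int_eq_if_mod_eight, ZMod.χ₈_int_eq_if_mod_eight,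
      ZMod.χ₄_int_eq_if_mod_four]
    simp only [hev2, Int.even_iff, h]
    have := Int.odd_iff.1 he
    have := Int.odd_iff.1 hd2
    clear hev hev2 hc8 hc8' hdet2 hdet had hr
    have h8 : (d : ℤ) % 8 = 1 ∨ (d : ℤ) % 8 = 3 ∨ (d : ℤ) % 8 = 5 ∨ (d : ℤ) % 8 = 7 := by omega
    have h4 : e % 4 = 1 ∨ e % 4 = 3 := by omega
    split_ifs <;> omega

end Jacobi

/-! ### Theta constants and the generators of the modular group -/

/-- The theta constant `∑_{n ∈ ℤ} exp (π i τ (n + 1/2)²)`. -/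
def theta2 (τ : ℂ) : ℂ := cexp (pi * I * τ / 4) * jacobiTheta₂ (τ / 2) τ

/-- The theta constant `∑_{n ∈ ℤ} exp (π i τ n²)`. -/
def theta3 (τ : ℂ) : ℂ := jacobiTheta₂ 0 τ

/-- The theta constant `∑_{n ∈ ℤ} (-1)ⁿ exp (π i τ n²)`. -/
def theta4 (τ : ℂ) : ℂ := jacobiTheta₂ (1 / 2) τ

theorem hasSum_theta2 {τ : ℂ} (hτ : 0 < τ.im) :
    HasSum (fun n : ℤ => cexp (pi * I * τ * (n + 1 / 2) ^ 2)) (theta2 τ) := by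
  refine ((hasSum_jacobiTheta₂_term (τ / 2) hτ).mul_left _).congr_fun ?_
  intro n
  rw [jacobiTheta₂_term, ← Complex.exp_add]
  congr 1
  ring

theorem hasSum_theta3 {τ : ℂ} (hτ : 0 < τ.im) :
    HasSum (fun n : ℤ => cexp (pi * I * τ * n ^ 2)) (theta3 τ) := by
  refine (hasSum_jacobiTheta₂_term 0 hτ).congr_fun ?_
  intro n
  rw [jacobiTheta₂_term]
  congr 1
  ring

theorem exp_pi_mul_int (n : ℤ) : cexp (pi * I * n) = (-1) ^ n := by
  rw [← Complex.exp_pi_mul_I, ← Complex.exp_int_mul]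
  congr 1
  ring

theorem hasSum_theta4 {τ : ℂ} (hτ : 0 < τ.im) :
    HasSum (fun n : ℤ => (-1) ^ n * cexp (pi * I * τ * n ^ 2)) (theta4 τ) := by
  refine (hasSum_jacobiTheta₂_term (1 / 2) hτ).congr_fun ?_
  intro n
  rw [jacobiTheta₂_term, ← exp_pi_mul_int, ← Complex.exp_add]
  congr 1
  ring

theorem exp_eq_exp_of_sub_eq_int {x y : ℂ} (n : ℤ) (h : x = y + n * (2 * pi * I)) :
    cexp x = cexp y := by
  rw [h, Complex.exp_add, Complex.exp_int_mul_two_pi_mul_I, mul_one]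

theorem theta3_add_one (τ : ℂ) : theta3 (τ + 1) = theta4 τ := by
  rw [theta3, theta4, jacobiTheta₂, jacobiTheta₂]
  refine tsum_congr fun n => ?_
  obtain ⟨m, hm⟩ := Int.even_mul_succ_self n
  have hm' : (n : ℂ) * (n + 1) = m + m := by exact_mod_cast hm
  refine exp_eq_exp_of_sub_eq_int (m - n) ?_
  push_cast
  linear_combination (pi * I) * hm'

theorem theta4_add_one (τ : ℂ) : theta4 (τ + 1) = theta3 τ := by
  rw [← theta3_add_one, theta3, theta3, add_assoc, one_add_one_eq_two, jacobiTheta₂_add_right]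

theorem theta2_add_one (τ : ℂ) : theta2 (τ + 1) = cexp (pi * I / 4) * theta2 τ := by
  rw [theta2, theta2, jacobiTheta₂, jacobiTheta₂, ← tsum_mul_left, ← tsum_mul_left,
    ← tsum_mul_left]
  refine tsum_congr fun n => ?_
  rw [jacobiTheta₂_term, jacobiTheta₂_term, ← Complex.exp_add, ← Complex.exp_add, ← Complex.exp_add]
  obtain ⟨m, hm⟩ := Int.even_mul_succ_self n
  have hm' : (n : ℂ) * (n + 1) = m + m := by exact_mod_cast hm
  refine exp_eq_exp_of_sub_eq_int m ?_
  linear_combination (pi * I) * hm'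

theorem theta3_eq_S (τ : ℂ) : theta3 τ = 1 / (-I * τ) ^ (1 / 2 : ℂ) * theta3 (-1 / τ) := by
  rw [theta3, theta3, jacobiTheta₂_functional_equation]
  simp

theorem theta2_eq_S {τ : ℂ} (hτ : τ ≠ 0) :
    theta2 τ = 1 / (-I * τ) ^ (1 / 2 : ℂ) * theta4 (-1 / τ) := by
  rw [theta2, theta4, jacobiTheta₂_functional_equation]
  have h1 : cexp (pi * I * τ / 4) * cexp (-pi * I * (τ / 2) ^ 2 / τ) = 1 := by
    rw [← Complex.exp_add, ← Complex.exp_zero]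
    congr 1
    field_simp
    ring
  have h2 : τ / 2 / τ = 1 / 2 := by field_simp
  rw [h2]
  linear_combination (1 / (-I * τ) ^ (1 / 2 : ℂ) * jacobiTheta₂ (1 / 2) (-1 / τ)) * h1

theorem theta4_eq_S {τ : ℂ} (hτ : τ ≠ 0) :
    theta4 τ = 1 / (-I * τ) ^ (1 / 2 : ℂ) * theta2 (-1 / τ) := by
  rw [theta2, theta4, jacobiTheta₂_functional_equation, ← jacobiTheta₂_neg_left (1 / 2 / τ),
    mul_assoc]
  congr 3
  · field_simp
    norm_num
  · field_simp

/-! ### Square roots of automorphy factors -/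

/-- Both arguments lie in $(-\pi/2,\pi/2)$, so their sum stays within the principal branch. -/
theorem cpow_half_mul {x y : ℂ} (hx : 0 < x.re) (hy : 0 < y.re) :
    (x * y) ^ (1 / 2 : ℂ) = x ^ (1 / 2 : ℂ) * y ^ (1 / 2 : ℂ) := by
  have hx0 : x ≠ 0 := by rintro rfl; simp at hx
  have hy0 : y ≠ 0 := by rintro rfl; simp at hy
  have h1 := abs_lt.1 (Complex.abs_arg_lt_pi_div_two_iff.2 (Or.inl hx))
  have h2 := abs_lt.1 (Complex.abs_arg_lt_pi_div_two_iff.2 (Or.inl hy))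
  rw [Complex.cpow_def_of_ne_zero hx0, Complex.cpow_def_of_ne_zero hy0,
    Complex.cpow_def_of_ne_zero (mul_ne_zero hx0 hy0), ← Complex.exp_add,
    Complex.log_mul hx0 hy0 ⟨by linarith, by linarith⟩]
  congr 1
  ring

theorem re_neg_I_mul {τ : ℂ} (hτ : 0 < τ.im) : 0 < (-I * τ).re := by simpa using hτ

theorem re_I_mul_add_div (c : ℂ) (hc : c.im = 0) {d : ℝ} (hd : 0 < d) {τ : ℂ} (hτ : 0 < τ.im) :
    0 < (I * (c + d / τ)).re := by
  have : 0 < normSq τ := Complex.normSq_pos.2 (by rintro rfl; simp at hτ)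
  simp [hc, Complex.div_im]
  positivity

/-- For $d>0$ both factors on the right lie in the right half-plane; this is why the multiplier of
`theta2` is stated for positive $d$. -/
theorem cpow_half_linear (c : ℝ) {d : ℝ} (hd : 0 < d) {τ : ℂ} (hτ : 0 < τ.im) :
    ((c : ℂ) * τ + d) ^ (1 / 2 : ℂ) = (-I * τ) ^ (1 / 2 : ℂ) * (I * (c + d / τ)) ^ (1 / 2 : ℂ) := by
  rw [← cpow_half_mul (re_neg_I_mul hτ) (re_I_mul_add_div _ (by simp) hd hτ)]
  congr 1
  have : τ ≠ 0 := by rintro rfl; simp at hτ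
  field_simp
  linear_combination (c * τ + d) * I_mul_I

theorem im_div_linear {c : ℝ} {τ : ℂ} (hτ : 0 < τ.im) : 0 < (τ / (c * τ + 1)).im := by
  have h0 : (c : ℂ) * τ + 1 ≠ 0 := by
    intro h
    have h1 := congrArg Complex.im h
    have h2 := congrArg Complex.re h
    simp at h1 h2
    rcases h1 with h1 | h1
    · simp [h1] at h2
    · exact hτ.ne' h1
  rw [Complex.div_im]
  have h : 0 < normSq (c * τ + 1) := Complex.normSq_pos.2 h0
  rw [div_sub_div_same]
  apply div_pos _ h
  simp
  nlinarith

theorem linear_ne_zero {c d : ℝ} (hd : d ≠ 0) {τ : ℂ} (hτ : 0 < τ.im) : (c : ℂ) * τ + d ≠ 0 := by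
  intro h
  have h1 := congrArg Complex.im h
  have h2 := congrArg Complex.re h
  simp at h1 h2
  rcases h1 with h1 | h1
  · simp [h1] at h2
    exact hd h2
  · exact hτ.ne' h1

theorem ne_zero_of_im_pos {τ : ℂ} (hτ : 0 < τ.im) : τ ≠ 0 := by rintro rfl; simp at hτ

theorem cpow_half_lower (e : ℝ) {τ : ℂ} (hτ : 0 < τ.im) :
    ((e : ℂ) * τ + 1) ^ (1 / 2 : ℂ) * (-I * (τ / (e * τ + 1))) ^ (1 / 2 : ℂ) =
      (-I * τ) ^ (1 / 2 : ℂ) := by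
  have hw := im_div_linear (c := e) hτ
  have h0 := ne_zero_of_im_pos hτ
  have h1 : (e : ℂ) * τ + 1 ≠ 0 := by
    simpa using linear_ne_zero (c := e) one_ne_zero hτ
  have h4 := cpow_half_linear e one_pos hτ
  have h5 : I * ((e : ℂ) + (1 : ℝ) / τ) = (-I * (τ / (e * τ + 1)))⁻¹ := by
    rw [mul_inv, inv_neg, Complex.inv_I]
    push_cast
    field_simp
  rw [h5, Complex.inv_cpow] at h4
  · push_cast at h4
    rw [h4, mul_assoc, inv_mul_cancel₀, mul_one]
    simp [Complex.cpow_eq_zero_iff, h0, h1]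
  · have := abs_lt.1 (Complex.abs_arg_lt_pi_div_two_iff.2 (Or.inl (re_neg_I_mul hw)))
    linarith [Real.pi_pos]

/-- The square roots of automorphy factors are multiplicative for lower triangular matrices on the
right, as long as the lower right entries are positive. -/
theorem cpow_half_cocycle (c e : ℝ) {d : ℝ} (hd : 0 < d) {τ : ℂ} (hτ : 0 < τ.im) :
    ((c : ℂ) * (τ / (e * τ + 1)) + d) ^ (1 / 2 : ℂ) * (e * τ + 1) ^ (1 / 2 : ℂ) =
      ((c + e * d : ℝ) * τ + d) ^ (1 / 2 : ℂ) := by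
  have h0 := ne_zero_of_im_pos hτ
  have h1 : (e : ℂ) * τ + 1 ≠ 0 := by
    simpa using linear_ne_zero (c := e) one_ne_zero hτ
  rw [cpow_half_linear c hd (im_div_linear hτ), cpow_half_linear (c + e * d) hd hτ,
    ← cpow_half_lower e hτ]
  have h6 : (c : ℂ) + d / (τ / (e * τ + 1)) = (c + e * d : ℝ) + d / τ := by
    push_cast
    field_simp
    ring
  rw [h6]
  ring

/-! ### `theta2` under $\Gamma_0(2)$ -/

/-- The inversion turns `theta2` into `theta4` and this map into the translation by $-2e$, under
which `theta4` is invariant. -/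
theorem theta2_lower {e : ℤ} (he : e = 1 ∨ e = -1) {τ : ℂ} (hτ : 0 < τ.im) :
    theta2 (τ / (2 * e * τ + 1)) = (2 * e * τ + 1) ^ (1 / 2 : ℂ) * theta2 τ := by
  have h0 := ne_zero_of_im_pos hτ
  have h2 := cpow_half_lower (2 * e) hτ
  have hw := im_div_linear (c := 2 * e) hτ
  have h1 := linear_ne_zero (c := 2 * e) one_ne_zero hτ
  push_cast at h1 hw h2
  have hw0 := ne_zero_of_im_pos hw
  have h3 : -1 / (τ / (2 * e * τ + 1)) = -1 / τ - 2 * e := by field_simp; ring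
  have h4 : theta4 (-1 / τ - 2 * e) = theta4 (-1 / τ) := by
    have (z : ℂ) : theta4 (z + 2) = theta4 z := jacobiTheta₂_add_right _ _
    rcases he with rfl | rfl
    · rw [← this (-1 / τ - 2 * (1 : ℤ))]; congr 1; push_cast; ring
    · rw [← this (-1 / τ)]; congr 1; push_cast; ring
  have h5 : (-I * (τ / (2 * e * τ + 1))) ^ (1 / 2 : ℂ) ≠ 0 := by
    simp [Complex.cpow_eq_zero_iff, h0, h1]
  have h6 : ((2 * e : ℂ) * τ + 1) ^ (1 / 2 : ℂ) ≠ 0 := by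
    simp [Complex.cpow_eq_zero_iff, h1]
  rw [theta2_eq_S hw0, theta2_eq_S h0, h3, h4, ← h2]
  generalize (-I * (τ / (2 * e * τ + 1))) ^ (1 / 2 : ℂ) = x at *
  generalize ((2 * e : ℂ) * τ + 1) ^ (1 / 2 : ℂ) = y at *
  field_simp

/-- The multiplier of `theta2` on matrices `(a, b; c, d)` with `c` even and `d > 0`. -/
def theta2Mult (b c : ℤ) (d : ℕ) : ℂ :=
  (jacobiSym c d : ℂ) * cexp (2 * pi * I * (b * d + d - 1) / 8)

/-- The exponent $bd+d-1$ grows by $1+c(2b+a+1)=1+4m$: the 1 is the eighth root of unity of the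
translation, and $4m$ gives the sign $(-1)^m$ that the Jacobi symbol loses. -/
theorem theta2Mult_add {a b c : ℤ} {d d' : ℕ} (hdet : a * d - b * c = 1) (hc : 2 ∣ c)
    (h : (d' : ℤ) = d + c) :
    theta2Mult (b + a) c d' = theta2Mult b c d * cexp (pi * I / 4) := by
  obtain ⟨m, hm, hJ⟩ := jacobiSym_add_self hdet hc h
  have hs : (((if Even m then 1 else -1 : ℤ) : ℤ) : ℂ) = cexp (pi * I * m) := by
    rw [exp_pi_mul_int]
    split_ifs with hev
    · simp [hev.neg_one_zpow]
    · simp [(Int.not_even_iff_odd.1 hev).neg_one_zpow]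
  have hm' : (c : ℂ) * (2 * b + a + 1) = 4 * m := by exact_mod_cast hm
  have hdet' : (a : ℂ) * d - b * c = 1 := by exact_mod_cast hdet
  have h' : (d' : ℂ) = d + c := by exact_mod_cast h
  rw [theta2Mult, theta2Mult, hJ, Int.cast_mul, hs, mul_assoc (jacobiSym c d' : ℂ),
    mul_assoc (jacobiSym c d' : ℂ), ← Complex.exp_add, ← Complex.exp_add]
  congr 1
  refine exp_eq_exp_of_sub_eq_int 0 ?_
  rw [h']
  push_cast
  linear_combination (pi * I / 4) * hm' + (pi * I / 4) * hdet'

/-- Descent on $|c|+d$ that keeps $d>0$: if $d<|c|$, $c$ is reduced by $\pm2d$, which changes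
neither $b$ nor $c$ modulo $d$; if $d>|c|$, $d$ is reduced by $|c|$. -/
theorem theta2_transform_aux (n : ℕ) : ∀ (a b c : ℤ) (d : ℕ) (τ : ℂ), c.natAbs + d = n →
    a * d - b * c = 1 → 2 ∣ c → 0 < d → 0 < τ.im →
    theta2 ((a * τ + b) / (c * τ + d)) =
      theta2Mult b c d * (c * τ + d) ^ (1 / 2 : ℂ) * theta2 τ := by
  induction n using Nat.strong_induction_on with
  | _ n ih =>
  intro a b c d τ hn hdet hc hd hτ
  rcases lt_trichotomy d c.natAbs with hlt | heq | hgt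
  · obtain ⟨e, he, hlt'⟩ : ∃ e : ℤ, (e = 1 ∨ e = -1) ∧ (c - 2 * e * d).natAbs < c.natAbs := by
      rcases le_total 0 c with h | h
      · exact ⟨1, Or.inl rfl, by omega⟩
      · exact ⟨-1, Or.inr rfl, by omega⟩
    have hτ' : 0 < (τ / (2 * e * τ + 1)).im := by
      have := im_div_linear (c := 2 * e) hτ
      push_cast at this
      exact this
    have h1 : (2 * e : ℂ) * τ + 1 ≠ 0 := by
      have := linear_ne_zero (c := 2 * e) one_ne_zero hτ
      push_cast at this
      exact this
    have key := ih _ (by omega) (a - 2 * e * b) b (c - 2 * e * d) d (τ / (2 * e * τ + 1)) rfl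
      (by linear_combination hdet) (dvd_sub hc ⟨e * d, by ring⟩) hd hτ'
    have h2 : ((a - 2 * e * b : ℤ) * (τ / (2 * e * τ + 1)) + b) /
        ((c - 2 * e * d : ℤ) * (τ / (2 * e * τ + 1)) + d) = (a * τ + b) / (c * τ + d) := by
      rw [← mul_div_mul_right _ _ h1]
      congr 1 <;> · push_cast; field_simp; ring
    have h3 : theta2Mult b (c - 2 * e * d) d = theta2Mult b c d := by
      rw [theta2Mult, theta2Mult]
      congr 2
      apply jacobiSym.mod_left'
      rw [Int.sub_mul_emod_self_right]
    have h4 := cpow_half_cocycle ((c - 2 * e * d : ℤ) : ℝ) (2 * e) (Nat.cast_pos.2 hd) hτ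
    have h5 : (((c - 2 * e * d : ℤ) : ℝ) + 2 * e * (d : ℝ)) = (c : ℝ) := by push_cast; ring
    rw [h5] at h4
    push_cast at h4 key h2
    rw [← h2, key, h3, theta2_lower he hτ, ← h4]
    ring
  -- With $d=|c|$, both $c$ and $d$ would be even, against determinant 1.
  · have hd2 : c = 2 * (c / 2) := by omega
    have : (2 : ℤ) ∣ 1 := by
      rw [← hdet]
      refine dvd_sub (Dvd.dvd.mul_left ?_ _) (Dvd.dvd.mul_left hc _)
      omega
    norm_num at this
  · rcases lt_trichotomy c 0 with hc0 | rfl | hc0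
    · obtain ⟨d', hd'⟩ := Int.eq_ofNat_of_zero_le (show 0 ≤ (d : ℤ) + c by omega)
      have key := ih _ (by omega : c.natAbs + d' < n) a (b + a) c d' (τ - 1) rfl
        (by rw [← hd']; linear_combination hdet) hc (by omega) (by simpa using hτ)
      have h' : (d' : ℂ) = d + c := by exact_mod_cast hd'.symm
      rw [theta2Mult_add hdet hc hd'.symm] at key
      have h2 := theta2_add_one (τ - 1)
      rw [sub_add_cancel] at h2
      rw [h2]
      have h3 : (a : ℂ) * (τ - 1) + (b + a : ℤ) = a * τ + b := by push_cast; ring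
      have h4 : (c : ℂ) * (τ - 1) + d' = c * τ + d := by rw [h']; ring
      rw [h3, h4] at key
      rw [key]
      ring
    · obtain rfl : d = 1 := by
        have := Int.eq_one_or_neg_one_of_mul_eq_one' (by simpa using hdet)
        omega
      have ha : a = 1 := by simpa using hdet
      have h1 : ∀ m : ℕ, ∀ z : ℂ, theta2 (z + m) = cexp (pi * I / 4 * m) * theta2 z := by
        intro m
        induction m with
        | zero => simp
        | succ m ihm =>
          intro z
          push_cast
          rw [← add_assoc, theta2_add_one, ihm, ← mul_assoc, ← Complex.exp_add]
          congr 2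
          ring
      have h2 : theta2 (τ + b) = cexp (pi * I / 4 * b) * theta2 τ := by
        obtain ⟨m, rfl | rfl⟩ := Int.eq_nat_or_neg b
        · simpa using h1 m τ
        · have := h1 m (τ + (-(m : ℤ) : ℤ))
          push_cast at this ⊢
          rw [neg_add_cancel_right] at this
          rw [this, ← mul_assoc, ← Complex.exp_add]
          simp
      subst ha
      simp only [theta2Mult, jacobiSym.one_right]
      push_cast
      simp only [one_mul, zero_mul, zero_add, div_one, h2, Complex.one_cpow, mul_one]
      congr 2
      ring
    · obtain ⟨d', hd'⟩ := Int.eq_ofNat_of_zero_le (show 0 ≤ (d : ℤ) - c by omega)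
      have hdet' : a * (d' : ℤ) - (b - a) * c = 1 := by rw [← hd']; linear_combination hdet
      have key := ih _ (by omega : c.natAbs + d' < n) a (b - a) c d' (τ + 1) rfl
        hdet' hc (by omega) (by simpa using hτ)
      have h' : (d' : ℂ) = d - c := by exact_mod_cast hd'.symm
      have hmu := theta2Mult_add (d' := d) hdet' hc (by omega)
      rw [sub_add_cancel] at hmu
      have h3 : (a : ℂ) * (τ + 1) + (b - a : ℤ) = a * τ + b := by push_cast; ring
      have h4 : (c : ℂ) * (τ + 1) + d' = c * τ + d := by rw [h']; ring
      rw [h3, h4, theta2_add_one] at key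
      rw [key, hmu]
      ring

/-- The transformation law of `theta2` under `Γ₀(2)`. -/
theorem theta2_transform {a b c : ℤ} {d : ℕ} (hdet : a * d - b * c = 1) (hc : 2 ∣ c) (hd : 0 < d)
    {τ : ℂ} (hτ : 0 < τ.im) :
    theta2 ((a * τ + b) / (c * τ + d)) =
      theta2Mult b c d * (c * τ + d) ^ (1 / 2 : ℂ) * theta2 τ :=
  theta2_transform_aux _ a b c d τ rfl hdet hc hd hτ

theorem summable_norm_theta2 {τ : ℂ} (hτ : 0 < τ.im) :
    Summable fun n : ℤ => ‖cexp (pi * I * τ * (n + 1 / 2) ^ 2)‖ :=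
  (hasSum_theta2 hτ).summable.norm

theorem summable_norm_theta3 {τ : ℂ} (hτ : 0 < τ.im) :
    Summable fun n : ℤ => ‖cexp (pi * I * τ * n ^ 2)‖ :=
  (hasSum_theta3 hτ).summable.norm

/-! ### `calF` in terms of theta constants -/

theorem hasSum_mul_prod {ι κ : Type*} {f : ι → ℂ} {g : κ → ℂ} {s t : ℂ} (hf : HasSum f s)
    (hg : HasSum g t) : HasSum (fun p : ι × κ => f p.1 * g p.2) (s * t) :=
  hf.mul hg (summable_mul_of_summable_norm hf.summable.norm hg.summable.norm)

/-- The parametrisation of the pairs `(m, n)` with `n ≡ r` modulo `2`. -/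
def parityPair (r : ℤ) (p : ℤ × ℤ) : ℤ × ℤ := (p.1 - p.2, 2 * p.2 + r)

theorem parityPair_injective (r : ℤ) : Function.Injective (parityPair r) := by
  rintro ⟨x, y⟩ ⟨x', y'⟩ h
  simp only [parityPair, Prod.mk.injEq] at h ⊢
  omega

theorem isCompl_range_parityPair :
    IsCompl (Set.range (parityPair 0)) (Set.range (parityPair 1)) := by
  rw [← compl_eq_iff_isCompl]
  ext ⟨m, n⟩
  simp only [parityPair, Set.mem_compl_iff, Set.mem_range, Prod.exists, Prod.mk.injEq]
  constructor
  · intro h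
    refine ⟨m + n / 2, n / 2, by omega, ?_⟩
    by_contra h'
    exact h ⟨m + n / 2, n / 2, by omega, by omega⟩
  · rintro ⟨x, y, h1, h2⟩ ⟨x', y', h3, h4⟩
    omega

theorem hasSum_calF_even {z : ℂ} (hz : 0 < z.im) :
    HasSum (fun p : ℤ × ℤ => cexp (2 * pi * I * z * (((parityPair 0 p).1 ^ 2 +
      (parityPair 0 p).1 * (parityPair 0 p).2 + (parityPair 0 p).2 ^ 2 : ℤ) : ℂ)))
      (theta3 (2 * z) * theta3 (6 * z)) := by
  have h2 : 0 < (2 * z).im := by simpa using hz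
  have h6 : 0 < (6 * z).im := by simpa using hz
  refine (hasSum_mul_prod (hasSum_theta3 h2) (hasSum_theta3 h6)).congr_fun fun p => ?_
  rw [← Complex.exp_add]
  congr 1
  simp only [parityPair]
  push_cast
  ring

theorem hasSum_calF_odd {z : ℂ} (hz : 0 < z.im) :
    HasSum (fun p : ℤ × ℤ => cexp (2 * pi * I * z * (((parityPair 1 p).1 ^ 2 +
      (parityPair 1 p).1 * (parityPair 1 p).2 + (parityPair 1 p).2 ^ 2 : ℤ) : ℂ)))
      (theta2 (2 * z) * theta2 (6 * z)) := by
  have h2 : 0 < (2 * z).im := by simpa using hz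
  have h6 : 0 < (6 * z).im := by simpa using hz
  refine (hasSum_mul_prod (hasSum_theta2 h2) (hasSum_theta2 h6)).congr_fun fun p => ?_
  rw [← Complex.exp_add]
  congr 1
  simp only [parityPair]
  push_cast
  ring

theorem hasSum_of_isCompl_range {α β : Type*} {i j : α → β} (hi : Function.Injective i)
    (hj : Function.Injective j) (hij : IsCompl (Set.range i) (Set.range j)) {f : β → ℂ} {s t : ℂ}
    (he : HasSum (fun p => f (i p)) s) (ho : HasSum (fun p => f (j p)) t) : HasSum f (s + t) :=
  HasSum.add_isCompl hij (hi.hasSum_range_iff.2 he) (hj.hasSum_range_iff.2 ho)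

theorem hasSum_calF {z : ℂ} (hz : 0 < z.im) :
    HasSum (fun p : ℤ × ℤ => cexp (2 * pi * I * z * ((p.1 ^ 2 + p.1 * p.2 + p.2 ^ 2 : ℤ) : ℂ)))
      (theta3 (2 * z) * theta3 (6 * z) + theta2 (2 * z) * theta2 (6 * z)) :=
  hasSum_of_isCompl_range (parityPair_injective 0) (parityPair_injective 1)
    isCompl_range_parityPair (hasSum_calF_even hz) (hasSum_calF_odd hz)

theorem calF_eq_theta {z : ℂ} (hz : 0 < z.im) :
    calF z = theta3 (2 * z) * theta3 (6 * z) + theta2 (2 * z) * theta2 (6 * z) :=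
  (hasSum_calF hz).tsum_eq

theorem hasSum_int_even_odd {f : ℤ → ℂ} {s t : ℂ} (he : HasSum (fun n => f (2 * n)) s)
    (ho : HasSum (fun n => f (2 * n + 1)) t) : HasSum f (s + t) := by
  have hi : Function.Injective fun n : ℤ => 2 * n := fun x y h => by
    simp only at h; omega
  have hj : Function.Injective fun n : ℤ => 2 * n + 1 := fun x y h => by
    simp only at h; omega
  have hij : IsCompl (Set.range fun n : ℤ => 2 * n) (Set.range fun n : ℤ => 2 * n + 1) := by
    rw [← compl_eq_iff_isCompl]
    ext n
    simp only [Set.mem_compl_iff, Set.mem_range]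
    constructor
    · intro h
      refine ⟨n / 2, ?_⟩
      by_contra h'
      exact h ⟨n / 2, by omega⟩
    · rintro ⟨x, h1⟩ ⟨x', h3⟩
      omega
  exact hasSum_of_isCompl_range hi hj hij he ho

theorem theta3_half {τ : ℂ} (hτ : 0 < τ.im) :
    theta3 (τ / 2) = theta3 (2 * τ) + theta2 (2 * τ) := by
  have h2 : 0 < (2 * τ).im := by simpa using hτ
  have h3 : 0 < (τ / 2).im := by simpa using hτ
  refine (hasSum_theta3 h3).unique (hasSum_int_even_odd ?_ ?_)
  · refine (hasSum_theta3 h2).congr_fun fun n => ?_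
    congr 1
    push_cast
    ring
  · refine (hasSum_theta2 h2).congr_fun fun n => ?_
    congr 1
    push_cast
    ring

theorem theta4_half {τ : ℂ} (hτ : 0 < τ.im) :
    theta4 (τ / 2) = theta3 (2 * τ) - theta2 (2 * τ) := by
  have h2 : 0 < (2 * τ).im := by simpa using hτ
  have h3 : 0 < (τ / 2).im := by simpa using hτ
  rw [sub_eq_add_neg]
  refine (hasSum_theta4 h3).unique (hasSum_int_even_odd ?_ ?_)
  · refine (hasSum_theta3 h2).congr_fun fun n => ?_
    rw [Even.neg_one_zpow (even_two_mul n), one_mul]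
    congr 1
    push_cast
    ring
  · refine (hasSum_theta2 h2).neg.congr_fun fun n => ?_
    rw [Odd.neg_one_zpow (odd_two_mul_add_one n), neg_one_mul, neg_inj]
    congr 1
    push_cast
    ring

theorem calF_eq_theta_half {τ : ℂ} (hτ : 0 < τ.im) :
    2 * calF τ = theta3 (3 * τ / 2) * theta3 (τ / 2) + theta4 (3 * τ / 2) * theta4 (τ / 2) := by
  have h3 : 0 < (3 * τ).im := by simpa using hτ
  rw [theta3_half hτ, theta3_half h3, theta4_half hτ, theta4_half h3, calF_eq_theta hτ,
    ← mul_assoc 2 3 τ]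
  norm_num
  ring

/-! ### `calF` under $\tau\mapsto-1/(3\tau)$ and under $\Gamma_0(3)$ -/

theorem im_neg_one_div_mul {τ : ℂ} (hτ : 0 < τ.im) {r : ℝ} (hr : 0 < r) :
    0 < (-1 / (r * τ)).im := by
  have h := ne_zero_of_im_pos hτ
  have : 0 < normSq (r * τ) := Complex.normSq_pos.2 (mul_ne_zero (by exact_mod_cast hr.ne') h)
  rw [Complex.div_im]
  simp only [neg_im, one_im, neg_zero, zero_mul, zero_div, neg_re, one_re, mul_im, ofReal_re,
    ofReal_im, zero_sub, add_zero]
  rw [neg_mul, one_mul, neg_div, neg_neg]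
  positivity

/-- The inversion fixes $\theta_3$ and exchanges $\theta_2$ with $\theta_4$, so it carries
`calF_eq_theta` at $\tau$ to `calF_eq_theta_half` at $-1/(3\tau)$. The value of $K$ is immaterial:
it is used twice and cancels in `calF_lower`. -/
theorem exists_calF_eq_S : ∃ K : ℂ, ∀ τ : ℂ, 0 < τ.im →
    calF τ = K / τ * calF (-1 / (3 * τ)) := by
  refine ⟨I / ((2 : ℂ) ^ (1 / 2 : ℂ) * 6 ^ (1 / 2 : ℂ)) * 2, fun τ hτ => ?_⟩
  have h0 := ne_zero_of_im_pos hτ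
  have hw : 0 < (-1 / (3 * τ)).im := by
    have := im_neg_one_div_mul hτ (r := 3) (by norm_num)
    push_cast at this
    exact this
  have hx := re_neg_I_mul hτ
  have e1 : (-I * (2 * τ)) ^ (1 / 2 : ℂ) = 2 ^ (1 / 2 : ℂ) * (-I * τ) ^ (1 / 2 : ℂ) := by
    rw [← cpow_half_mul (by norm_num) hx]; congr 1; ring
  have e2 : (-I * (6 * τ)) ^ (1 / 2 : ℂ) = 6 ^ (1 / 2 : ℂ) * (-I * τ) ^ (1 / 2 : ℂ) := by
    rw [← cpow_half_mul (by norm_num) hx]; congr 1; ring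
  have e3 : (-I * τ) ^ (1 / 2 : ℂ) * (-I * τ) ^ (1 / 2 : ℂ) = -I * τ := by
    rw [← Complex.cpow_add _ _ (mul_ne_zero (neg_ne_zero.2 I_ne_zero) h0)]
    norm_num
  have hS := calF_eq_theta_half hw
  have a1 : 3 * (-1 / (3 * τ)) / 2 = -1 / (2 * τ) := by field_simp
  have a2 : (-1 / (3 * τ)) / 2 = -1 / (6 * τ) := by field_simp; norm_num
  rw [a1, a2] at hS
  have e4 : (2 : ℂ) ^ (1 / 2 : ℂ) ≠ 0 := by simp [Complex.cpow_eq_zero_iff]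
  have e5 : (6 : ℂ) ^ (1 / 2 : ℂ) ≠ 0 := by simp [Complex.cpow_eq_zero_iff]
  have e6 : (-I * τ) ^ (1 / 2 : ℂ) ≠ 0 := by simp [Complex.cpow_eq_zero_iff, h0]
  rw [calF_eq_theta hτ, theta3_eq_S (2 * τ), theta3_eq_S (6 * τ),
    theta2_eq_S (mul_ne_zero two_ne_zero h0), theta2_eq_S (mul_ne_zero (by norm_num) h0), e1, e2]
  have e8 : I / (2 ^ (1 / 2 : ℂ) * 6 ^ (1 / 2 : ℂ)) * 2 / τ * calF (-1 / (3 * τ)) =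
      I / (2 ^ (1 / 2 : ℂ) * 6 ^ (1 / 2 : ℂ)) / τ * (2 * calF (-1 / (3 * τ))) := by ring
  have e9 : I / τ = 1 / ((-I * τ) ^ (1 / 2 : ℂ) * (-I * τ) ^ (1 / 2 : ℂ)) := by
    rw [e3, div_eq_div_iff h0 (mul_ne_zero (neg_ne_zero.2 I_ne_zero) h0)]
    linear_combination (-τ) * I_mul_I
  rw [e8, hS, div_right_comm, e9]
  generalize (-I * τ) ^ (1 / 2 : ℂ) = x at *
  generalize (2 : ℂ) ^ (1 / 2 : ℂ) = y at *
  generalize (6 : ℂ) ^ (1 / 2 : ℂ) = z at *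
  field_simp

theorem calF_add_int (τ : ℂ) (n : ℤ) : calF (τ + n) = calF τ := by
  refine tsum_congr fun p => ?_
  refine exp_eq_exp_of_sub_eq_int (n * (p.1 ^ 2 + p.1 * p.2 + p.2 ^ 2)) ?_
  push_cast
  ring

theorem calF_lower (e : ℤ) {τ : ℂ} (hτ : 0 < τ.im) :
    calF (τ / (3 * e * τ + 1)) = (3 * e * τ + 1) * calF τ := by
  have h0 := ne_zero_of_im_pos hτ
  have hw := im_div_linear (c := 3 * e) hτ
  have h1 := linear_ne_zero (c := 3 * e) one_ne_zero hτ
  push_cast at h1 hw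
  obtain ⟨K, hK⟩ := exists_calF_eq_S
  have h3 : -1 / (3 * (τ / (3 * e * τ + 1))) = -1 / (3 * τ) + (-e : ℤ) := by
    push_cast; field_simp; ring
  rw [hK _ hw, h3, calF_add_int, hK _ hτ]
  field_simp

theorem legendreSym_three_eq {d d' : ℤ} (h : (3 : ℤ) ∣ d' - d) :
    legendreSym 3 d' = legendreSym 3 d := by
  have : (d' : ZMod 3) = d := ((ZMod.intCast_eq_intCast_iff_dvd_sub d d' 3).2 h).symm
  rw [legendreSym, legendreSym, this]

theorem calF_transform_aux (n : ℕ) : ∀ (a b c d : ℤ) (τ : ℂ), c.natAbs + d.natAbs = n →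
    a * d - b * c = 1 → 3 ∣ c → 0 < τ.im →
    calF ((a * τ + b) / (c * τ + d)) = legendreSym 3 d * (c * τ + d) * calF τ := by
  induction n using Nat.strong_induction_on with
  | _ n ih =>
  intro a b c d τ hn hdet hc hτ
  have hd : d ≠ 0 := by
    rintro rfl
    have : (3 : ℤ) ∣ 1 := by
      rw [← hdet, mul_zero]
      exact dvd_sub (dvd_zero _) (Dvd.dvd.mul_left hc _)
    norm_num at this
  rcases eq_or_ne c 0 with rfl | hc0
  · have : d = 1 ∨ d = -1 := Int.eq_one_or_neg_one_of_mul_eq_one' (by simpa using hdet) |>.imp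
      And.right And.right
    rcases this with rfl | rfl
    · obtain rfl : a = 1 := by simpa using hdet
      simp [calF_add_int]
    · obtain rfl : a = -1 := by omega
      have : legendreSym 3 (-1) = -1 := by decide
      have h2 : (((-1 : ℤ) : ℂ) * τ + b) / ((0 : ℤ) * τ + (-1 : ℤ)) = τ + (-b : ℤ) := by
        push_cast; ring
      rw [h2, calF_add_int, this]
      push_cast
      ring
  -- The step $d\mapsto d\pm c$ can decrease $|d|$ when $0<|c|<2|d|$, and $c\mapsto c\pm3d$ can
  -- decrease $|c|$ when $0<3|d|<2|c|$. The threshold lies in the overlap of the two ranges.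
  rcases le_or_gt (2 * c.natAbs) (3 * d.natAbs) with hle | hgt
  · obtain ⟨e, hlt⟩ : ∃ e : ℤ, (d - e * c).natAbs < d.natAbs := by
      rcases le_total 0 c with h | h <;> rcases le_total 0 d with h' | h'
      · exact ⟨1, by omega⟩
      · exact ⟨-1, by omega⟩
      · exact ⟨-1, by omega⟩
      · exact ⟨1, by omega⟩
    have key := ih _ (by omega) a (b - e * a) c (d - e * c) (τ + e) rfl
      (by linear_combination hdet) hc (by simpa using hτ)
    have h3 : (a : ℂ) * (τ + e) + (b - e * a : ℤ) = a * τ + b := by push_cast; ring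
    have h4 : (c : ℂ) * (τ + e) + (d - e * c : ℤ) = c * τ + d := by push_cast; ring
    rw [h3, h4, calF_add_int] at key
    rw [key, legendreSym_three_eq]
    exact ⟨-(e * (c / 3)), by obtain ⟨t, rfl⟩ := hc; simp; ring⟩
  · obtain ⟨e, hlt⟩ : ∃ e : ℤ, (c - 3 * e * d).natAbs < c.natAbs := by
      rcases le_total 0 c with h | h <;> rcases le_total 0 d with h' | h'
      · exact ⟨1, by omega⟩
      · exact ⟨-1, by omega⟩
      · exact ⟨-1, by omega⟩
      · exact ⟨1, by omega⟩
    have hτ' : 0 < (τ / (3 * e * τ + 1)).im := by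
      have := im_div_linear (c := 3 * e) hτ
      push_cast at this
      exact this
    have h1 : (3 * e : ℂ) * τ + 1 ≠ 0 := by
      have := linear_ne_zero (c := 3 * e) one_ne_zero hτ
      push_cast at this
      exact this
    have key := ih _ (by omega) (a - 3 * e * b) b (c - 3 * e * d) d (τ / (3 * e * τ + 1)) rfl
      (by linear_combination hdet) (dvd_sub hc ⟨e * d, by ring⟩) hτ'
    have h2 : ((a - 3 * e * b : ℤ) * (τ / (3 * e * τ + 1)) + b) /
        ((c - 3 * e * d : ℤ) * (τ / (3 * e * τ + 1)) + d) = (a * τ + b) / (c * τ + d) := by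
      rw [← mul_div_mul_right _ _ h1]
      congr 1 <;> · push_cast; field_simp; ring
    rw [← h2, key, calF_lower e hτ]
    push_cast
    field_simp
    ring

/-- The transformation law of `calF` under `Γ₀(3)`. -/
theorem calF_transform {a b c d : ℤ} (hdet : a * d - b * c = 1) (hc : 3 ∣ c) {τ : ℂ}
    (hτ : 0 < τ.im) :
    calF ((a * τ + b) / (c * τ + d)) = legendreSym 3 d * (c * τ + d) * calF τ :=
  calF_transform_aux _ a b c d τ rfl hdet hc hτ

/-! ### Growth at the cusps -/

open UpperHalfPlane hiding I

/-- The sum of the absolute values of the three theta constants. -/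
def thetaSum (τ : ℂ) : ℝ := ‖theta2 τ‖ + ‖theta3 τ‖ + ‖theta4 τ‖

theorem thetaSum_nonneg (τ : ℂ) : 0 ≤ thetaSum τ := by unfold thetaSum; positivity

theorem thetaSum_add_one (τ : ℂ) : thetaSum (τ + 1) = thetaSum τ := by
  have : ‖cexp (pi * I / 4)‖ = 1 := by
    rw [show (pi * I / 4 : ℂ) = (pi / 4 : ℝ) * I by push_cast; ring, norm_exp_ofReal_mul_I]
  rw [thetaSum, thetaSum, theta2_add_one, theta3_add_one, theta4_add_one, norm_mul, this]
  ring

theorem thetaSum_eq_S {τ : ℂ} (hτ : τ ≠ 0) :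
    thetaSum τ ^ 4 * ‖τ‖ ^ 2 = thetaSum (-1 / τ) ^ 4 := by
  have h1 : thetaSum τ = ‖(-I * τ) ^ (1 / 2 : ℂ)‖⁻¹ * thetaSum (-1 / τ) := by
    rw [thetaSum, theta2_eq_S hτ, theta3_eq_S, theta4_eq_S hτ, thetaSum]
    simp only [norm_mul, norm_div, norm_one]
    ring
  have h2 : ‖(-I * τ) ^ (1 / 2 : ℂ)‖ ^ 4 = ‖τ‖ ^ 2 := by
    have h3 : ((-I * τ) ^ (1 / 2 : ℂ)) ^ 2 = -I * τ := by
      rw [one_div]; exact_mod_cast Complex.cpow_nat_inv_pow (-I * τ) two_ne_zero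
    rw [show 4 = 2 * 2 from rfl, pow_mul, ← norm_pow, h3]
    simp
  have h4 : ‖τ‖ ^ 2 ≠ 0 := by simpa using hτ
  rw [h1, mul_pow, inv_pow, h2]
  field_simp

/-- Up to automorphy factors, the generators $S$ and $T$ permute the three theta constants, so
invariance holds on generators and hence everywhere. -/
theorem im_mul_thetaSum_smul (γ : SL(2, ℤ)) (τ : ℍ) :
    thetaSum (γ • τ : ℍ) ^ 4 * (γ • τ : ℍ).im = thetaSum τ ^ 4 * τ.im := by
  have hγ : γ ∈ Subgroup.closure {ModularGroup.S, ModularGroup.T} := by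
    rw [SpecialLinearGroup.SL2Z_generators]; trivial
  have hS (τ : ℍ) : thetaSum (ModularGroup.S • τ : ℍ) ^ 4 * (ModularGroup.S • τ : ℍ).im =
      thetaSum τ ^ 4 * τ.im := by
    have h0 := τ.ne_zero
    rw [modular_S_smul]
    have h1 := thetaSum_eq_S h0
    simp only [mk_im, inv_im, neg_im, neg_neg, normSq_neg, coe_im]
    rw [show (-(τ : ℂ))⁻¹ = -1 / τ by rw [inv_neg, neg_div, one_div], ← h1, normSq_eq_norm_sq]
    have : ‖(τ : ℂ)‖ ^ 2 ≠ 0 := by simpa using h0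
    field_simp
  have hT (τ : ℍ) : thetaSum (ModularGroup.T • τ : ℍ) ^ 4 * (ModularGroup.T • τ : ℍ).im =
      thetaSum τ ^ 4 * τ.im := by
    rw [modular_T_smul, coe_vadd, vadd_im, add_comm, ofReal_one, thetaSum_add_one]
  induction hγ using Subgroup.closure_induction generalizing τ with
  | mem x hx =>
    rcases hx with rfl | rfl
    · exact hS τ
    · exact hT τ
  | one => rw [one_smul]
  | mul x y _ _ hx hy => rw [mul_smul, hx, hy]
  | inv x _ hx => rw [← hx, smul_inv_smul]

theorem norm_exp_quadratic_le {τ : ℂ} (hτ : 1 ≤ τ.im) (x : ℝ) :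
    ‖cexp (pi * I * τ * x ^ 2)‖ ≤ ‖cexp (pi * I * I * x ^ 2)‖ := by
  rw [norm_exp, norm_exp, Real.exp_le_exp]
  have h1 : (pi * I * τ * x ^ 2).re = -(pi * x ^ 2 * τ.im) := by
    rw [← ofReal_pow]; generalize x ^ 2 = y; simp; ring
  have h2 : (pi * I * I * x ^ 2).re = -(pi * x ^ 2) := by
    rw [← ofReal_pow]; generalize x ^ 2 = y; simp
  rw [h1, h2, neg_le_neg_iff]
  exact le_mul_of_one_le_right (by have := Real.pi_pos; positivity) hτ

/-- Each term is largest in absolute value on the line $\operatorname{Im}\tau=1$, so the series at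
$i$ dominate. -/
theorem exists_thetaSum_le : ∃ C : ℝ, ∀ τ : ℂ, 1 ≤ τ.im → thetaSum τ ≤ C := by
  have hI : 0 < I.im := by simp
  refine ⟨(∑' n : ℤ, ‖cexp (pi * I * I * (n + 1 / 2) ^ 2)‖) +
    (∑' n : ℤ, ‖cexp (pi * I * I * n ^ 2)‖) + ∑' n : ℤ, ‖cexp (pi * I * I * n ^ 2)‖,
    fun τ hτ => ?_⟩
  have hτ' : 0 < τ.im := by linarith
  refine add_le_add (add_le_add ?_ ?_) ?_
  · rw [← (hasSum_theta2 hτ').tsum_eq]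
    refine tsum_of_norm_bounded (summable_norm_theta2 hI).hasSum fun n => ?_
    have := norm_exp_quadratic_le hτ (n + 1 / 2)
    push_cast at this
    exact this
  · rw [← (hasSum_theta3 hτ').tsum_eq]
    refine tsum_of_norm_bounded (summable_norm_theta3 hI).hasSum fun n => ?_
    exact_mod_cast norm_exp_quadratic_le hτ n
  · rw [← (hasSum_theta4 hτ').tsum_eq]
    refine tsum_of_norm_bounded (summable_norm_theta3 hI).hasSum fun n => ?_
    rw [norm_mul, norm_zpow, norm_neg, norm_one, one_zpow, one_mul]
    exact_mod_cast norm_exp_quadratic_le hτ n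

/-- The point `m · γτ` is equivalent under `SL(2, ℤ)` to `(g τ + B) / D` with integers
`g, D > 0` and `B`. -/
theorem exists_mul_smul_eq_smul {m : ℕ} (hm : 0 < m) (γ : SL(2, ℤ)) :
    ∃ r : ℝ, 0 < r ∧ ∀ τ : ℍ, ∃ (γ' : SL(2, ℤ)) (z : ℍ), z.im = r * τ.im ∧
      ((γ' • z : ℍ) : ℂ) = m * (γ • τ : ℍ) := by
  set a := γ 0 0 with ha
  set b := γ 0 1 with hb
  set c := γ 1 0 with hc
  set d := γ 1 1 with hd
  have hdet : a * d - b * c = 1 := by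
    have := γ.det_coe
    rwa [Matrix.det_fin_two] at this
  have hgpos : 0 < Int.gcd (m * a) c := by
    rw [Int.gcd_pos_iff]
    by_contra! h
    obtain ⟨h1, h2⟩ := h
    have h3 : a = 0 := by simpa [hm.ne'] using h1
    simp [h2, h3] at hdet
  -- Hermite normal form:
  -- $\operatorname{diag}(m,1)\gamma=\gamma'\begin{pmatrix}g&B\\0&D\end{pmatrix}$, where $g$ is the
  -- gcd of the first column on the left and a Bézout relation completes $(p,r)$ to $\gamma'$.
  obtain ⟨p, r, hcop, hp, hr⟩ := Int.exists_gcd_one hgpos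
  obtain ⟨u, v, huv⟩ := Int.isCoprime_iff_gcd_eq_one.2 hcop
  set g : ℕ := Int.gcd (m * a) c with hg
  set D : ℤ := p * d - r * m * b with hD
  set B : ℤ := u * (m * b) + v * d with hB
  have hgD : (g : ℤ) * D = m := by
    rw [hD]; linear_combination (-d) * hp + (m * b) * hr + m * hdet
  have hDpos : 0 < D := by
    have : 0 < (g : ℤ) * D := by rw [hgD]; exact_mod_cast hm
    exact pos_of_mul_pos_right this (by positivity)
  have hDR : (0 : ℝ) < D := by exact_mod_cast hDpos
  have hgR : (0 : ℝ) < g := by exact_mod_cast hgpos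
  refine ⟨g / D, by positivity, fun τ => ?_⟩
  have hzim : ((g * (τ : ℂ) + B) / D).im = g / D * τ.im := by
    rw [show (g * (τ : ℂ) + B) / D = ((g / D : ℝ) : ℂ) * τ + ((B / D : ℝ) : ℂ) by
      push_cast; ring]
    simp
  obtain ⟨γ', h00, h01, h10, h11⟩ : ∃ γ' : SL(2, ℤ),
      γ' 0 0 = p ∧ γ' 0 1 = -v ∧ γ' 1 0 = r ∧ γ' 1 1 = u :=
    ⟨⟨!![p, -v; r, u], by rw [Matrix.det_fin_two_of]; linear_combination huv⟩, rfl, rfl, rfl, rfl⟩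
  obtain ⟨z, hz⟩ : ∃ z : ℍ, (z : ℂ) = (g * (τ : ℂ) + B) / D :=
    ⟨⟨_, by rw [hzim]; have := τ.im_pos; positivity⟩, rfl⟩
  refine ⟨γ', z, by rw [← coe_im, hz, hzim], ?_⟩
  have hden : (c : ℂ) * τ + d ≠ 0 := denom_ne_zero γ τ
  rw [coe_specialLinearGroup_apply, coe_specialLinearGroup_apply]
  have hDC : (D : ℂ) ≠ 0 := by exact_mod_cast hDpos.ne'
  have hgC : (g : ℂ) ≠ 0 := by exact_mod_cast hgpos.ne'
  have hpC : (m : ℂ) * a = p * g := by exact_mod_cast hp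
  have hrC : (c : ℂ) = r * g := by exact_mod_cast hr
  have huvC : (u : ℂ) * p + v * r = 1 := by exact_mod_cast huv
  have hDC' : (D : ℂ) = p * d - r * m * b := by rw [hD]; push_cast; ring
  have hBC : (B : ℂ) = u * (m * b) + v * d := by rw [hB]; push_cast; ring
  simp only [h00, h01, h10, h11, hz, algebraMap_int_eq, eq_intCast, ofReal_intCast, ← ha, ← hb,
    ← hc, ← hd]
  have e1 : (p : ℂ) * ((g * τ + B) / D) + (-v : ℤ) = m * (a * τ + b) / D := by
    field_simp
    rw [hBC, hDC']
    push_cast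
    linear_combination (-(τ : ℂ)) * hpC + (m * b) * huvC
  have e2 : (r : ℂ) * ((g * τ + B) / D) + u = (c * τ + d) / D := by
    field_simp
    rw [hBC, hDC']
    linear_combination (-(τ : ℂ)) * hrC + d * huvC
  rw [e1, e2]
  field_simp

/-- By invariance, `thetaSum` at $m\gamma\tau$ is governed by its value at a point of imaginary part
$r\operatorname{Im}\tau$, where it is bounded; the ratio of imaginary parts supplies $|c\tau+d|^2$.
-/
theorem thetaSum_isBigO {m : ℕ} (hm : 0 < m) (γ : SL(2, ℤ)) :
    (fun τ : ℍ => thetaSum (m * (γ • τ : ℍ)) ^ 4) =O[atImInfty]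
      fun τ : ℍ => (denom γ τ) ^ 2 := by
  obtain ⟨r, hr, h⟩ := exists_mul_smul_eq_smul hm γ
  obtain ⟨C, hC⟩ := exists_thetaSum_le
  refine Asymptotics.IsBigO.of_bound (C ^ 4 * r / m) ?_
  refine (atImInfty_mem _).2 ⟨1 / r, fun τ hτ => ?_⟩
  obtain ⟨γ', z, hz, hmul⟩ := h τ
  have hz1 : 1 ≤ z.im := by
    rw [hz]; rwa [div_le_iff₀' hr] at hτ
  have h1 := im_mul_thetaSum_smul γ' z
  have h2 : (γ' • z : ℍ).im = m * (τ.im / normSq (denom γ τ)) := by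
    rw [← ModularGroup.im_smul_eq_div_normSq, ← coe_im, hmul]
    simp
  have hn : 0 < normSq (denom γ τ) := normSq_denom_pos γ τ.im_ne_zero
  have hmR : (0 : ℝ) < m := by exact_mod_cast hm
  have hτ0 := τ.im_pos
  rw [hmul, h2, hz] at h1
  change ‖thetaSum (m * (γ • τ : ℍ)) ^ 4‖ ≤ C ^ 4 * r / m * ‖denom γ τ ^ 2‖
  rw [Real.norm_of_nonneg (pow_nonneg (thetaSum_nonneg _) _), norm_pow, ← normSq_eq_norm_sq]
  have h3 : thetaSum z ^ 4 ≤ C ^ 4 := pow_le_pow_left₀ (thetaSum_nonneg _) (hC _ hz1) 4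
  have h4 : thetaSum (m * (γ • τ : ℍ)) ^ 4 = thetaSum z ^ 4 * r / m * normSq (denom γ τ) := by
    field_simp at h1 ⊢
    linear_combination h1
  rw [h4]
  gcongr

theorem theta2_isBigO {m : ℕ} (hm : 0 < m) (γ : SL(2, ℤ)) :
    (fun τ : ℍ => theta2 (m * (γ • τ : ℍ)) ^ 4) =O[atImInfty] fun τ : ℍ => (denom γ τ) ^ 2 := by
  refine (Asymptotics.IsBigO.of_norm_le fun τ => ?_).trans (thetaSum_isBigO hm γ)
  rw [norm_pow]
  refine pow_le_pow_left₀ (norm_nonneg _) ?_ _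
  unfold thetaSum
  linarith [norm_nonneg (theta3 (m * (γ • τ : ℍ))), norm_nonneg (theta4 (m * (γ • τ : ℍ)))]

theorem calF_isBigO {m : ℕ} (hm : 0 < m) (γ : SL(2, ℤ)) :
    (fun τ : ℍ => calF (m * (γ • τ : ℍ)) ^ 4) =O[atImInfty] fun τ : ℍ => (denom γ τ) ^ 4 := by
  have h := (thetaSum_isBigO (m := 2 * m) (by positivity) γ).mul
    (thetaSum_isBigO (m := 6 * m) (by positivity) γ)
  simp only [← pow_add, Nat.reduceAdd] at h
  refine (Asymptotics.IsBigO.of_norm_le fun τ => ?_).trans h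
  rw [norm_pow, ← mul_pow]
  refine pow_le_pow_left₀ (norm_nonneg _) ?_ _
  have him : 0 < ((m : ℂ) * (γ • τ : ℍ)).im := by
    have := (γ • τ : ℍ).im_pos
    have h' : (0 : ℝ) < m := by exact_mod_cast hm
    simp only [mul_im, natCast_re, natCast_im, zero_mul, add_zero, coe_im]
    positivity
  rw [calF_eq_theta him]
  push_cast
  rw [mul_assoc 2, mul_assoc 6]
  generalize (m : ℂ) * (γ • τ : ℍ) = z
  refine (norm_add_le _ _).trans ?_
  rw [norm_mul, norm_mul]
  unfold thetaSum
  have := norm_nonneg (theta2 (2 * z))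
  have := norm_nonneg (theta3 (2 * z))
  have := norm_nonneg (theta4 (2 * z))
  have := norm_nonneg (theta2 (6 * z))
  have := norm_nonneg (theta3 (6 * z))
  have := norm_nonneg (theta4 (6 * z))
  -- Once expanded, the difference is a sum of products of norms.
  rw [← sub_nonneg]
  ring_nf
  positivity

/-! ### The generating function as a product -/

theorem hasSum_prod_pi {β : Type*} : ∀ {n : ℕ} {g : Fin n → β → ℂ} {s : Fin n → ℂ},
    (∀ i, HasSum (g i) (s i)) → HasSum (fun x : Fin n → β => ∏ i, g i (x i)) (∏ i, s i) := by
  intro n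
  induction n with
  | zero => intro g s _; simp
  | succ n ih =>
    intro g s h
    rw [← (Fin.consEquiv fun _ => β).hasSum_iff, Fin.prod_univ_succ]
    have := hasSum_mul_prod (h 0) (ih fun i => h i.succ)
    refine this.congr_fun fun p => ?_
    simp [Fin.prod_univ_succ, Fin.consEquiv]

theorem two_mul_triangular (n : ℕ) : 2 * triangular n = n * (n + 1) :=
  Nat.mul_div_cancel' (Nat.even_mul_succ_self n).two_dvd

theorem two_mul_triangular_cast (n : ℕ) : 2 * (triangular n : ℂ) = n * (n + 1) := by
  exact_mod_cast two_mul_triangular n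

theorem hasSum_Psi {z : ℂ} (hz : 0 < z.im) :
    HasSum (fun n : ℕ => cexp (2 * pi * I * z * (triangular n : ℂ))) (Psi z) := by
  refine Summable.hasSum ?_
  have h := ((hasSum_theta2 hz).summable.comp_injective Nat.cast_injective).mul_left
    (cexp (-(pi * I * z / 4)))
  refine h.congr fun n => ?_
  rw [Function.comp_apply, ← Complex.exp_add]
  congr 1
  push_cast
  linear_combination (-(pi * I * z)) * two_mul_triangular_cast n

/-- The indices $n$ and $-n-1$ give the same $(n+1/2)^2=2T_n+1/4$. -/
theorem theta2_eq_Psi {z : ℂ} (hz : 0 < z.im) :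
    theta2 z = 2 * (cexp (2 * pi * I * z / 8) * Psi z) := by
  have h := (hasSum_Psi hz).mul_left (cexp (2 * pi * I * z / 8))
  rw [two_mul]
  refine (hasSum_theta2 hz).unique (HasSum.of_nat_of_neg_add_one ?_ ?_)
  · refine h.congr_fun fun n => ?_
    rw [← Complex.exp_add]
    congr 1
    push_cast
    linear_combination (-(pi * I * z)) * two_mul_triangular_cast n
  · refine h.congr_fun fun n => ?_
    rw [← Complex.exp_add]
    congr 1
    push_cast
    linear_combination (-(pi * I * z)) * two_mul_triangular_cast n

theorem mixedForm_nonneg {u k : ℕ} (a : Fin u → ℕ) (c : Fin k → ℕ) (x : Fin u → ℤ × ℤ)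
    (z : Fin k → ℕ) : 0 ≤ mixedForm a c x z := by
  refine add_nonneg (Finset.sum_nonneg fun i _ => mul_nonneg (by positivity) ?_)
    (Finset.sum_nonneg fun j _ => by positivity)
  nlinarith [sq_nonneg ((x i).1 + (x i).2), sq_nonneg (x i).1, sq_nonneg (x i).2]

theorem im_natCast_mul_pos {m : ℕ} (hm : 0 < m) {τ : ℂ} (hτ : 0 < τ.im) : 0 < (m * τ).im := by
  have : (0 : ℝ) < m := by exact_mod_cast hm
  simp only [mul_im, natCast_re, natCast_im, zero_mul, add_zero]
  positivity

theorem hasSum_mixedForm {u k : ℕ} {a : Fin u → ℕ} {c : Fin k → ℕ} (ha : ∀ i, 0 < a i)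
    (hc : ∀ j, 0 < c j) {τ : ℂ} (hτ : 0 < τ.im) :
    HasSum (fun p : (Fin u → ℤ × ℤ) × (Fin k → ℕ) =>
        cexp (2 * pi * I * τ * (mixedForm a c p.1 p.2 : ℂ)))
      ((∏ i, calF (a i * τ)) * ∏ j, Psi (c j * τ)) := by
  have hF (i : Fin u) := hasSum_calF (im_natCast_mul_pos (ha i) hτ)
  simp_rw [← calF_eq_theta (im_natCast_mul_pos (ha _) hτ)] at hF
  have hP (j : Fin k) := hasSum_Psi (im_natCast_mul_pos (hc j) hτ)
  refine (hasSum_mul_prod (hasSum_prod_pi hF) (hasSum_prod_pi hP)).congr_fun fun p => ?_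
  rw [← Complex.exp_sum, ← Complex.exp_sum, ← Complex.exp_add, mixedForm]
  congr 1
  push_cast
  rw [mul_add, Finset.mul_sum, Finset.mul_sum]
  congr 1 <;> exact Finset.sum_congr rfl fun _ _ => by ring

theorem hasSum_repNum {u k : ℕ} {a : Fin u → ℕ} {c : Fin k → ℕ} (ha : ∀ i, 0 < a i)
    (hc : ∀ j, 0 < c j) {τ : ℂ} (hτ : 0 < τ.im) :
    HasSum (fun n : ℕ => (repNum a c n : ℂ) * cexp (2 * pi * I * τ) ^ n)
      ((∏ i, calF (a i * τ)) * ∏ j, Psi (c j * τ)) := by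
  have h := (hasSum_mixedForm ha hc hτ).tsum_fiberwise fun p => (mixedForm a c p.1 p.2).toNat
  refine h.congr_fun fun n => ?_
  have hset : ((fun p : (Fin u → ℤ × ℤ) × (Fin k → ℕ) => (mixedForm a c p.1 p.2).toNat) ⁻¹' {n}) =
      {p | mixedForm a c p.1 p.2 = (n : ℤ)} := by
    ext p
    have := mixedForm_nonneg a c p.1 p.2
    simp only [Set.mem_preimage, Set.mem_singleton_iff, Set.mem_ofPred_eq]
    omega
  -- The fibre need not be shown finite: on an infinite one, the sum of a constant and `ncard` both
  -- default to 0.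
  rw [hset, tsum_congr (g := fun _ => cexp (2 * pi * I * τ) ^ n), tsum_const, nsmul_eq_mul,
    repNum, Set.ncard]
  · rfl
  · rintro ⟨p, hp⟩
    have hp' : mixedForm a c p.1 p.2 = (n : ℤ) := hp
    simp only
    rw [hp', ← Complex.exp_nat_mul]
    congr 1
    push_cast
    ring

/-! ### The Kronecker symbol and the product of the multipliers -/

section Character

open scoped NumberTheorySymbols

theorem kroneckerSym_odd (D : ℤ) {n : ℤ} (hn : Odd n) :
    kroneckerSym D n = (if n < 0 ∧ D < 0 then -1 else 1) * J(D | n.natAbs) := by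
  have h0 : n ≠ 0 := by rintro rfl; simp at hn
  have hp : padicValNat 2 n.natAbs = 0 := by
    apply padicValNat.eq_zero_of_not_dvd
    have := Int.natAbs_odd.2 hn
    rwa [← even_iff_two_dvd, Nat.not_even_iff_odd]
  rw [kroneckerSym, if_neg h0, hp]
  simp

theorem kroneckerSym_neg (D : ℤ) {n : ℤ} (hn : Odd n) :
    kroneckerSym D (-n) = (if D < 0 then -1 else 1) * kroneckerSym D n := by
  rw [kroneckerSym_odd D hn, kroneckerSym_odd D hn.neg, Int.natAbs_neg]
  have h0 : n ≠ 0 := by rintro rfl; simp at hn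
  rcases lt_or_gt_of_ne h0 with h | h
  · by_cases hD : D < 0 <;> simp [h, hD, h.le]
  · by_cases hD : D < 0 <;> simp [h, hD, h.le]

theorem kroneckerSym_mul (D : ℤ) {m n : ℤ} (hm : Odd m) (hn : Odd n) :
    kroneckerSym D (m * n) = kroneckerSym D m * kroneckerSym D n := by
  have hm0 : m ≠ 0 := by rintro rfl; simp at hm
  have hn0 : n ≠ 0 := by rintro rfl; simp at hn
  rw [kroneckerSym_odd D hm, kroneckerSym_odd D hn, kroneckerSym_odd D (hm.mul hn), Int.natAbs_mul,
    jacobiSym.mul_right' _ (Int.natAbs_ne_zero.2 hm0) (Int.natAbs_ne_zero.2 hn0)]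
  by_cases hD : D < 0
  · rcases lt_or_gt_of_ne hm0 with h | h <;> rcases lt_or_gt_of_ne hn0 with h' | h'
    · simp [hD, h, h', (mul_pos_of_neg_of_neg h h').le]
    · simp [hD, h, h'.le, mul_neg_of_neg_of_pos h h']
    · simp [hD, h.le, h', mul_neg_of_pos_of_neg h h']
    · simp [hD, h.not_gt, h'.not_gt, (mul_pos h h').not_gt]
  · simp [hD]

/-- The values of the character of the generating function of a mixed form. -/
def mixedChar (u : ℕ) {k : ℕ} (c : Fin k → ℕ) (d : ℤ) : ℤ :=
  (if Even u then 1 else legendreSym 3 d) *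
    kroneckerSym ((-1) ^ (k / 2) * 4 * ∏ j, (c j : ℤ)) d

variable {u k : ℕ} {c : Fin k → ℕ}

theorem mixedChar_one : mixedChar u c 1 = 1 := by
  rw [mixedChar, kroneckerSym_odd _ odd_one]
  simp

theorem mixedChar_mul {m n : ℤ} (hm : Odd m) (hn : Odd n) :
    mixedChar u c (m * n) = mixedChar u c m * mixedChar u c n := by
  rw [mixedChar, mixedChar, mixedChar, kroneckerSym_mul _ hm hn]
  split_ifs
  · ring
  · rw [legendreSym.mul]
    ring

theorem legendreSym_three_neg (d : ℤ) : legendreSym 3 (-d) = -legendreSym 3 d := by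
  rw [← neg_one_mul d, legendreSym.mul, show legendreSym 3 (-1) = -1 by decide, neg_one_mul]

theorem legendreSym_three_pow {d : ℤ} (hd : ¬ (3 : ℤ) ∣ d) (u : ℕ) :
    legendreSym 3 d ^ u = if Even u then 1 else legendreSym 3 d := by
  have h : legendreSym 3 d ^ 2 = 1 := by
    refine legendreSym.sq_one 3 ?_
    rwa [Ne, ZMod.intCast_zmod_eq_zero_iff_dvd]
  split_ifs with hu
  · obtain ⟨v, rfl⟩ := hu
    rw [← two_mul, pow_mul, h, one_pow]
  · obtain ⟨v, rfl⟩ := Nat.not_even_iff_odd.1 hu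
    rw [pow_add, pow_mul, h, one_pow, one_mul, pow_one]

/-- The character has the parity of the weight, as $-1\in\Gamma_0(L)$ demands; this gives the case
$d<0$ of the transformation law. -/
theorem mixedChar_neg (hc : ∀ j, 0 < c j) {d : ℤ} (hd : Odd d) :
    mixedChar u c (-d) = (-1) ^ (u + k / 2) * mixedChar u c d := by
  have hP : (0 : ℤ) < ∏ j, (c j : ℤ) := Finset.prod_pos fun j _ => by exact_mod_cast hc j
  have hD : (if (-1 : ℤ) ^ (k / 2) * 4 * ∏ j, (c j : ℤ) < 0 then -1 else 1 : ℤ) = (-1) ^ (k / 2) := by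
    rcases neg_one_pow_eq_or ℤ (k / 2) with h | h
    · rw [h, if_neg]
      rw [not_lt]; positivity
    · rw [h, if_pos]
      linarith
  rw [mixedChar, mixedChar, kroneckerSym_neg _ hd, hD, pow_add]
  split_ifs with hu
  · rw [hu.neg_one_pow]; ring
  · rw [(Nat.not_even_iff_odd.1 hu).neg_one_pow, legendreSym_three_neg]; ring

theorem exp_eq_neg_one_pow {k' d : ℕ} (hd : Odd d) :
    cexp (2 * pi * I * (k' * (d - 1)) / 4) = ((-1 : ℤ) ^ (d / 2)) ^ k' := by
  obtain ⟨e, rfl⟩ := hd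
  have h1 : (2 * e + 1) / 2 = e := by omega
  have h2 : (((-1 : ℤ) ^ e) ^ k' : ℂ) = (-1) ^ ((e * k' : ℕ) : ℤ) := by
    rw [zpow_natCast, pow_mul]
    push_cast
    rfl
  rw [h1]
  push_cast at h2 ⊢
  rw [h2, ← Nat.cast_mul, ← exp_pi_mul_int]
  congr 1
  push_cast
  ring

/-- Since $e_jc_j=C$ and $k$ is even,
$\prod_j\left(\frac{e_jc_j}{d}\right)=\left(\frac{C}{d}\right)^k=1$, so each $e_j$ may be replaced
by $c_j$. The exponents add up to $bdh+k(d-1)$; the first term disappears because $8\mid h$, and the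
second gives $\left(\frac{-1}{d}\right)^{k/2}$. -/
theorem prod_theta2Mult (hk : Even k) (h8 : 8 ∣ ∑ j, c j) {b : ℤ}
    {C : ℤ} {e : Fin k → ℤ} (he : ∀ j, e j * c j = C) {d : ℕ} (hcop : IsCoprime C d) (hd : Odd d) :
    ∏ j, theta2Mult (b * c j) (e j) d =
      kroneckerSym ((-1) ^ (k / 2) * 4 * ∏ j, (c j : ℤ)) d := by
  have hd' : Odd (d : ℤ) := by simpa using hd
  obtain ⟨k', hk'⟩ := hk
  obtain ⟨h, hh⟩ := h8
  have hk2 : k / 2 = k' := by omega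
  have hJC : J(C | d) ^ 2 = 1 := jacobiSym.sq_one (Int.isCoprime_iff_gcd_eq_one.1 hcop)
  have hprod : ∀ f : Fin k → ℤ, ∏ j, J(f j | d) = J(∏ j, f j | d) := by
    intro f
    exact (map_prod (⟨⟨fun x : ℤ => J(x | d), jacobiSym.one_left d⟩,
      fun x y => jacobiSym.mul_left x y d⟩ : ℤ →* ℤ) f Finset.univ).symm
  have hJ : ∏ j, J(e j | d) = ∏ j, J((c j : ℤ) | d) := by
    refine Int.eq_of_mul_eq_one ?_
    rw [← Finset.prod_mul_distrib]
    simp_rw [← jacobiSym.mul_left, he]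
    rw [Finset.prod_const, Finset.card_univ, Fintype.card_fin, hk', ← two_mul, pow_mul, hJC,
      one_pow]
  have hexp : ∏ j : Fin k, cexp (2 * pi * I * ((b * c j : ℤ) * d + d - 1) / 8) =
      cexp (2 * pi * I * (k' * (d - 1)) / 4) := by
    rw [← Complex.exp_sum]
    refine exp_eq_exp_of_sub_eq_int (b * d * h) ?_
    rw [← Finset.sum_div, ← Finset.mul_sum]
    have hs : ∑ j : Fin k, (((b * c j : ℤ) : ℂ) * d + d - 1) =
        b * d * (∑ j, c j : ℕ) + k * (d - 1) := by
      simp only [add_sub_assoc, Finset.sum_add_distrib, Finset.sum_const, Finset.card_univ,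
        Fintype.card_fin, nsmul_eq_mul]
      push_cast
      rw [Finset.mul_sum]
      congr 1
      exact Finset.sum_congr rfl fun j _ => by ring
    rw [hs, hh, hk']
    push_cast
    ring
  simp only [theta2Mult]
  rw [Finset.prod_mul_distrib, hexp, exp_eq_neg_one_pow hd, kroneckerSym_odd _ hd', hk2,
    if_neg (by simp), Int.natAbs_natCast, jacobiSym.mul_left, jacobiSym.mul_left,
    jacobiSym.at_four hd, jacobiSym.pow_left, jacobiSym.at_neg_one hd,
    ZMod.χ₄_eq_neg_one_pow (Nat.odd_iff.1 hd), ← hprod, ← hJ]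
  push_cast
  ring

end Character

/-! ### The product and its transformation under $\Gamma_0(L)$ -/

variable {u k : ℕ} {a : Fin u → ℕ} {c : Fin k → ℕ}

/-- The product of theta functions `q^(h/8) ψ(τ)`. -/
def mixedTheta (a : Fin u → ℕ) (c : Fin k → ℕ) (τ : ℂ) : ℂ :=
  (∏ i, calF (a i * τ)) * ∏ j, (theta2 (c j * τ) / 2)

theorem mixedTheta_eq (ha : ∀ i, 0 < a i) (hc : ∀ j, 0 < c j) {τ : ℂ} (hτ : 0 < τ.im) :
    mixedTheta a c τ =
      cexp (2 * pi * I * τ * ((∑ j, c j : ℕ) : ℂ) / 8) * psiLT a c τ := by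
  have h1 : psiLT a c τ = _ := (hasSum_repNum ha hc hτ).tsum_eq
  have h2 (j : Fin k) : theta2 (c j * τ) / 2 =
      cexp (2 * pi * I * (c j * τ) / 8) * Psi (c j * τ) := by
    rw [theta2_eq_Psi (im_natCast_mul_pos (hc j) hτ), mul_div_cancel_left₀ _ two_ne_zero]
  rw [h1, mixedTheta, Finset.prod_congr rfl fun j _ => h2 j, Finset.prod_mul_distrib,
    ← Complex.exp_sum]
  have h3 : ∑ j, 2 * pi * I * (c j * τ) / 8 = 2 * pi * I * τ * ((∑ j, c j : ℕ) : ℂ) / 8 := by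
    push_cast
    rw [Finset.mul_sum, Finset.sum_div]
    exact Finset.sum_congr rfl fun j _ => by ring
  rw [h3]
  ring

/-- Conjugation by $\operatorname{diag}(m,1)$: lower left entry $C/m$, upper right entry $Bm$, and
the same $d$. -/
theorem mul_moebius {m A B C d e : ℤ} (hm : e * m = C) (τ : ℂ) :
    (m : ℂ) * ((A * τ + B) / (C * τ + d)) = (A * (m * τ) + (B * m : ℤ)) / (e * (m * τ) + d) := by
  rw [← hm]
  push_cast
  rw [mul_div_assoc']
  congr 1 <;> ring

theorem three_mul_dvd_level (i : Fin u) : 3 * a i ∣ level a c :=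
  (Nat.mul_dvd_mul_left 3 (Finset.dvd_lcm (Finset.mem_univ i))).trans (Nat.dvd_lcm_left _ _)

theorem two_mul_dvd_level (j : Fin k) : 2 * c j ∣ level a c :=
  (Nat.mul_dvd_mul_left 2 (Finset.dvd_lcm (Finset.mem_univ j))).trans (Nat.dvd_lcm_right _ _)

theorem two_dvd_level : 2 ∣ level a c := (Nat.dvd_mul_right 2 _).trans (Nat.dvd_lcm_right _ _)

theorem three_dvd_level : 3 ∣ level a c := (Nat.dvd_mul_right 3 _).trans (Nat.dvd_lcm_left _ _)

theorem level_ne_zero (ha : ∀ i, 0 < a i) (hc : ∀ j, 0 < c j) : level a c ≠ 0 := by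
  refine Nat.lcm_ne_zero (mul_ne_zero (by norm_num) ?_) (mul_ne_zero (by norm_num) ?_)
  · simp only [Ne, Finset.lcm_eq_zero_iff]
    rintro ⟨i, _, hi⟩
    exact (ha i).ne' hi
  · simp only [Ne, Finset.lcm_eq_zero_iff]
    rintro ⟨i, _, hi⟩
    exact (hc i).ne' hi

theorem odd_of_isCoprime_level {d : ℤ} (hd : IsCoprime d (level a c : ℤ)) : Odd d := by
  have h2 : (2 : ℤ) ∣ level a c := by exact_mod_cast two_dvd_level (a := a) (c := c)
  rw [← Int.not_even_iff_odd, even_iff_two_dvd]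
  intro h'
  have h := Int.isUnit_iff.1 (hd.isUnit_of_dvd' h' h2)
  norm_num at h

theorem not_three_dvd_of_isCoprime_level {d : ℤ} (hd : IsCoprime d (level a c : ℤ)) :
    ¬ (3 : ℤ) ∣ d := by
  have h3 : (3 : ℤ) ∣ level a c := by exact_mod_cast three_dvd_level (a := a) (c := c)
  intro h'
  have h := Int.isUnit_iff.1 (hd.isUnit_of_dvd' h' h3)
  norm_num at h

theorem mixedTheta_transform_pos (hk : Even k) (ha : ∀ i, 0 < a i) (hc : ∀ j, 0 < c j)
    (h8 : 8 ∣ ∑ j, c j) {A B C : ℤ} {d : ℕ} (hdet : A * d - B * C = 1)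
    (hC : (level a c : ℤ) ∣ C) (hd : 0 < d) {τ : ℂ} (hτ : 0 < τ.im) :
    mixedTheta a c ((A * τ + B) / (C * τ + d)) =
      mixedChar u c d * (C * τ + d) ^ (u + k / 2) * mixedTheta a c τ := by
  have hcop : IsCoprime C (d : ℤ) := ⟨-B, A, by linarith⟩
  have hcopL : IsCoprime (d : ℤ) (level a c : ℤ) := (hcop.of_isCoprime_of_dvd_left hC).symm
  have hodd : Odd d := by simpa using odd_of_isCoprime_level hcopL
  have h3 := not_three_dvd_of_isCoprime_level hcopL
  have hF (i : Fin u) : calF (a i * ((A * τ + B) / (C * τ + d))) =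
      legendreSym 3 d * (C * τ + d) * calF (a i * τ) := by
    obtain ⟨e, he⟩ : ((3 * a i : ℕ) : ℤ) ∣ C :=
      (Int.natCast_dvd_natCast.2 (three_mul_dvd_level i)).trans hC
    have he' : 3 * e * (a i : ℤ) = C := by rw [he]; push_cast; ring
    have h1 := mul_moebius (A := A) (B := B) (d := d) he' τ
    have h2 := calF_transform (a := A) (b := B * a i) (c := 3 * e) (d := d)
      (by rw [← hdet, ← he']; ring) (Dvd.intro _ rfl) (im_natCast_mul_pos (ha i) hτ)
    have h3 : ((3 * e : ℤ) : ℂ) * (a i * τ) = C * τ := by rw [← he']; push_cast; ring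
    push_cast at h1 h2 h3
    rw [h1, h2, h3]
  choose e he using fun j : Fin k =>
    (Int.natCast_dvd_natCast.2 (two_mul_dvd_level (a := a) (c := c) j)).trans hC
  have he' (j : Fin k) : 2 * e j * (c j : ℤ) = C := by rw [he j]; push_cast; ring
  have hT (j : Fin k) : theta2 (c j * ((A * τ + B) / (C * τ + d))) / 2 =
      theta2Mult (B * c j) (2 * e j) d * ((C * τ + d) ^ (1 / 2 : ℂ) * (theta2 (c j * τ) / 2)) := by
    have h1 := mul_moebius (A := A) (B := B) (d := d) (he' j) τ
    have h2 := theta2_transform (a := A) (b := B * c j) (c := 2 * e j) (d := d)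
      (by rw [← hdet, ← he' j]; ring) (Dvd.intro _ rfl) hd (im_natCast_mul_pos (hc j) hτ)
    have h3 : ((2 * e j : ℤ) : ℂ) * (c j * τ) = C * τ := by rw [← he' j]; push_cast; ring
    push_cast at h1 h2 h3
    rw [h1, h2, h3]
    ring
  have hsq : ((C * τ + d) ^ (1 / 2 : ℂ)) ^ k = (C * τ + d) ^ (k / 2) := by
    conv_lhs => rw [← Nat.two_mul_div_two_of_even hk, pow_mul]
    congr 1
    rw [one_div]
    exact_mod_cast Complex.cpow_nat_inv_pow (C * τ + d : ℂ) two_ne_zero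
  rw [mixedTheta, mixedTheta, Finset.prod_congr rfl fun i _ => hF i,
    Finset.prod_congr rfl fun j _ => hT j]
  simp only [Finset.prod_mul_distrib, prod_theta2Mult hk h8 he' hcop hodd, Finset.prod_const,
    Finset.card_univ, Fintype.card_fin, hsq]
  rw [mixedChar, ← legendreSym_three_pow h3, pow_add]
  push_cast
  ring

theorem mixedTheta_transform (hk : Even k) (ha : ∀ i, 0 < a i) (hc : ∀ j, 0 < c j)
    (h8 : 8 ∣ ∑ j, c j) {A B C d : ℤ} (hdet : A * d - B * C = 1)
    (hC : (level a c : ℤ) ∣ C) {τ : ℂ} (hτ : 0 < τ.im) :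
    mixedTheta a c ((A * τ + B) / (C * τ + d)) =
      mixedChar u c d * (C * τ + d) ^ (u + k / 2) * mixedTheta a c τ := by
  have hcop : IsCoprime C (d : ℤ) := ⟨-B, A, by linarith⟩
  have hodd := odd_of_isCoprime_level (hcop.of_isCoprime_of_dvd_left hC).symm
  have h0 : d ≠ 0 := by rintro rfl; simp at hodd
  obtain ⟨n, rfl | rfl⟩ := Int.eq_nat_or_neg d
  · simpa using mixedTheta_transform_pos hk ha hc h8 hdet hC (by omega) hτ
  · have hodd' : Odd (n : ℤ) := by simpa using hodd
    have h := mixedTheta_transform_pos hk ha hc h8 (A := -A) (B := -B) (C := -C) (d := n)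
      (by linear_combination hdet) (by simpa using hC) (by omega) hτ
    have h1 : ((-A : ℤ) * τ + (-B : ℤ)) / ((-C : ℤ) * τ + n) =
        (A * τ + B) / (C * τ + (-(n : ℤ) : ℤ)) := by
      rw [← neg_div_neg_eq]
      congr 1 <;> · push_cast; ring
    have h2 : ((-C : ℤ) * τ + n : ℂ) = -1 * (C * τ + (-(n : ℤ) : ℤ)) := by push_cast; ring
    rw [h1, h2, mul_pow] at h
    rw [h, mixedChar_neg hc hodd']
    push_cast
    ring

theorem mixedTheta_slash (hk : Even k) (ha : ∀ i, 0 < a i) (hc : ∀ j, 0 < c j)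
    (h8 : 8 ∣ ∑ j, c j) {γ : SL(2, ℤ)} (hγ : γ ∈ CongruenceSubgroup.Gamma0 (level a c)) :
    (fun τ : ℍ => mixedTheta a c τ) ∣[((u + k / 2 : ℕ) : ℤ)] γ =
      (mixedChar u c (γ 1 1) : ℂ) • fun τ : ℍ => mixedTheta a c τ := by
  ext τ
  have hC : (level a c : ℤ) ∣ γ 1 0 :=
    (ZMod.intCast_zmod_eq_zero_iff_dvd _ _).1 (CongruenceSubgroup.Gamma0_mem.1 hγ)
  have hdet : γ 0 0 * γ 1 1 - γ 0 1 * γ 1 0 = 1 := by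
    have := γ.det_coe
    rwa [Matrix.det_fin_two] at this
  have h := mixedTheta_transform hk ha hc h8 hdet hC τ.im_pos
  have hden : denom γ τ = (γ 1 0 : ℂ) * τ + (γ 1 1 : ℤ) := rfl
  have hne := denom_ne_zero γ τ
  rw [ModularForm.SL_slash_apply, coe_specialLinearGroup_apply, Pi.smul_apply, smul_eq_mul]
  simp only [algebraMap_int_eq, eq_intCast, ofReal_intCast]
  rw [h, ← hden, zpow_neg, zpow_natCast]
  field_simp

theorem isCoprime_of_mem_Gamma0 {N : ℕ} {γ : SL(2, ℤ)} (hγ : γ ∈ CongruenceSubgroup.Gamma0 N) :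
    IsCoprime (γ 1 1) (N : ℤ) := by
  have hC : (N : ℤ) ∣ γ 1 0 :=
    (ZMod.intCast_zmod_eq_zero_iff_dvd _ _).1 (CongruenceSubgroup.Gamma0_mem.1 hγ)
  have hdet : γ 0 0 * γ 1 1 - γ 0 1 * γ 1 0 = 1 := by
    have := γ.det_coe
    rwa [Matrix.det_fin_two] at this
  exact IsCoprime.of_isCoprime_of_dvd_right ⟨γ 0 0, -γ 0 1, by linarith⟩ hC

/-! ### Non-vanishing -/

theorem ne_zero_of_hasSum_exp {ι : Type*} [Nonempty ι] {f : ι → ℂ} {r : ι → ℝ} {s : ℂ}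
    (h : HasSum f s) (hf : ∀ i, f i = cexp (r i)) : s ≠ 0 := by
  have h1 := Complex.hasSum_re h
  have h2 : ∀ i, 0 < (f i).re := fun i => by
    rw [hf, ← ofReal_exp, ofReal_re]
    exact Real.exp_pos _
  intro h0
  obtain ⟨i⟩ := ‹Nonempty ι›
  have h3 := h1.summable.tsum_pos (fun j => (h2 j).le) i (h2 i)
  rw [h1.tsum_eq, h0] at h3
  simp at h3

/-- At $\tau=i$ every term of every series is a positive real number. -/
theorem mixedTheta_I_ne_zero (ha : ∀ i, 0 < a i) (hc : ∀ j, 0 < c j) : mixedTheta a c I ≠ 0 := by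
  have hI : 0 < I.im := by simp
  refine mul_ne_zero (Finset.prod_ne_zero_iff.2 fun i _ => ?_)
    (Finset.prod_ne_zero_iff.2 fun j _ => div_ne_zero ?_ two_ne_zero)
  · have h := hasSum_calF (im_natCast_mul_pos (ha i) hI)
    rw [← calF_eq_theta (im_natCast_mul_pos (ha i) hI)] at h
    refine ne_zero_of_hasSum_exp
      (r := fun p => -(2 * pi * a i * (p.1 ^ 2 + p.1 * p.2 + p.2 ^ 2))) h fun p => ?_
    congr 1
    push_cast
    linear_combination (2 * pi * a i * (p.1 ^ 2 + p.1 * p.2 + p.2 ^ 2)) * I_mul_I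
  · refine ne_zero_of_hasSum_exp (r := fun n : ℤ => -(pi * c j * (n + 1 / 2) ^ 2))
      (hasSum_theta2 (im_natCast_mul_pos (hc j) hI)) fun n => ?_
    congr 1
    push_cast
    linear_combination (pi * c j * (n + 1 / 2 : ℂ) ^ 2) * I_mul_I

/-! ### The character -/

/-- For $\gamma\in\Gamma_0(L)$ with lower row $(L,d)$, $\gamma T$ has lower right entry $d+L$, while
$T$ acts trivially on the function. Comparing multipliers at $i$, where the function is nonzero,
replaces an argument by reciprocity. -/
theorem mixedChar_add_level (hk : Even k) (ha : ∀ i, 0 < a i) (hc : ∀ j, 0 < c j)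
    (h8 : 8 ∣ ∑ j, c j) {d : ℤ} (hd : IsCoprime d (level a c : ℤ)) :
    mixedChar u c (d + level a c) = mixedChar u c d := by
  obtain ⟨x, y, hxy⟩ := hd
  let γ : SL(2, ℤ) := ⟨!![x, -y; (level a c : ℤ), d], by
    rw [Matrix.det_fin_two_of]; linear_combination hxy⟩
  have hγ : γ ∈ CongruenceSubgroup.Gamma0 (level a c) := by
    rw [CongruenceSubgroup.Gamma0_mem]
    change (((level a c : ℕ) : ℤ) : ZMod (level a c)) = 0
    simp
  have hT : ModularGroup.T ∈ CongruenceSubgroup.Gamma0 (level a c) := by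
    rw [CongruenceSubgroup.Gamma0_mem]
    simp [ModularGroup.T]
  have h1 := mixedTheta_slash hk ha hc h8 (mul_mem hγ hT)
  have hentry : (γ * ModularGroup.T) 1 1 = d + level a c := by
    rw [Matrix.SpecialLinearGroup.coe_mul, Matrix.mul_apply, Fin.sum_univ_two]
    change (level a c : ℤ) * 1 + d * 1 = _
    ring
  have hT1 : ModularGroup.T 1 1 = 1 := by simp [ModularGroup.T]
  rw [SlashAction.slash_mul, mixedTheta_slash hk ha hc h8 hγ, ModularForm.SL_smul_slash,
    mixedTheta_slash hk ha hc h8 hT, hentry, hT1, mixedChar_one, Int.cast_one, one_smul] at h1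
  have h2 := congrFun h1 UpperHalfPlane.I
  simp only [Pi.smul_apply, smul_eq_mul] at h2
  have h3 := mul_right_cancel₀ (mixedTheta_I_ne_zero ha hc) h2
  exact_mod_cast h3.symm

theorem mixedChar_congr (hk : Even k) (ha : ∀ i, 0 < a i) (hc : ∀ j, 0 < c j)
    (h8 : 8 ∣ ∑ j, c j) {d d' : ℤ} (hd : IsCoprime d (level a c : ℤ))
    (h : (level a c : ℤ) ∣ d' - d) : mixedChar u c d' = mixedChar u c d := by
  have key : ∀ n : ℕ, ∀ d : ℤ, IsCoprime d (level a c : ℤ) →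
      mixedChar u c (d + n * level a c) = mixedChar u c d := by
    intro n
    induction n with
    | zero => simp
    | succ n ih =>
      intro d hd
      push_cast
      rw [add_one_mul, ← add_assoc, mixedChar_add_level hk ha hc h8, ih d hd]
      exact (IsCoprime.add_mul_right_left_iff).2 hd
  obtain ⟨t, ht⟩ := h
  obtain ⟨n, rfl | rfl⟩ := Int.eq_nat_or_neg t
  · rw [← key n d hd]
    congr 1
    linarith
  · have hd' : IsCoprime d' (level a c : ℤ) := by
      rw [show d' = d + (-(n : ℤ)) * level a c by linarith]
      exact (IsCoprime.add_mul_right_left_iff).2 hd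
    rw [← key n d' hd']
    congr 1
    linarith

/-! ### Holomorphy and growth -/

theorem differentiableAt_theta2 {τ : ℂ} (hτ : 0 < τ.im) : DifferentiableAt ℂ theta2 τ := by
  unfold theta2
  refine DifferentiableAt.mul (by fun_prop) ?_
  exact (hasFDerivAt_jacobiTheta₂ (τ / 2) hτ).differentiableAt.comp
    (f := fun τ : ℂ => (τ / 2, τ)) τ (by fun_prop)

theorem differentiableAt_theta3 {τ : ℂ} (hτ : 0 < τ.im) : DifferentiableAt ℂ theta3 τ :=
  differentiableAt_jacobiTheta₂_snd 0 hτ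

theorem isOpen_im_pos : IsOpen {z : ℂ | 0 < z.im} := isOpen_lt continuous_const continuous_im

theorem differentiableAt_calF {τ : ℂ} (hτ : 0 < τ.im) : DifferentiableAt ℂ calF τ := by
  have h2 : 0 < (2 * τ).im := by simpa using hτ
  have h6 : 0 < (6 * τ).im := by simpa using hτ
  have h : DifferentiableAt ℂ
      (fun z => theta3 (2 * z) * theta3 (6 * z) + theta2 (2 * z) * theta2 (6 * z)) τ := by
    refine DifferentiableAt.add (.mul ?_ ?_) (.mul ?_ ?_)
    · exact (differentiableAt_theta3 h2).comp τ (by fun_prop)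
    · exact (differentiableAt_theta3 h6).comp τ (by fun_prop)
    · exact (differentiableAt_theta2 h2).comp τ (by fun_prop)
    · exact (differentiableAt_theta2 h6).comp τ (by fun_prop)
  refine h.congr_of_eventuallyEq ?_
  filter_upwards [isOpen_im_pos.mem_nhds hτ] with z hz using calF_eq_theta hz

theorem differentiableAt_mixedTheta (ha : ∀ i, 0 < a i) (hc : ∀ j, 0 < c j) {τ : ℂ}
    (hτ : 0 < τ.im) : DifferentiableAt ℂ (mixedTheta a c) τ := by
  unfold mixedTheta
  refine DifferentiableAt.mul (DifferentiableAt.fun_finsetProd fun i _ => ?_)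
    (DifferentiableAt.fun_finsetProd fun j _ => DifferentiableAt.div_const ?_ _)
  · exact (differentiableAt_calF (im_natCast_mul_pos (ha i) hτ)).comp τ (by fun_prop)
  · exact (differentiableAt_theta2 (im_natCast_mul_pos (hc j) hτ)).comp τ (by fun_prop)

/-- Fourth powers avoid half-integral weights: the factors contribute $4u+2k=4(u+k/2)$ powers of
$c\tau+d$, exactly what the slash action removes. -/
theorem isBoundedAtImInfty_mixedTheta_slash (hk : Even k) (ha : ∀ i, 0 < a i)
    (hc : ∀ j, 0 < c j) (γ : SL(2, ℤ)) :
    IsBoundedAtImInfty ((fun τ : ℍ => mixedTheta a c τ) ∣[((u + k / 2 : ℕ) : ℤ)] γ) := by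
  have h2 (j : Fin k) : (fun τ : ℍ => (theta2 (c j * (γ • τ : ℍ)) / 2) ^ 4) =O[atImInfty]
      fun τ : ℍ => (denom γ τ) ^ 2 := by
    simp_rw [div_pow, div_eq_inv_mul]
    exact (theta2_isBigO (hc j) γ).const_mul_left _
  have h := (Asymptotics.IsBigO.finsetProd (s := Finset.univ) fun i _ => calF_isBigO (ha i) γ).mul
    (Asymptotics.IsBigO.finsetProd (s := Finset.univ) fun j _ => h2 j)
  have hone : (fun τ : ℍ => ((fun τ : ℍ => mixedTheta a c τ) ∣[((u + k / 2 : ℕ) : ℤ)] γ) τ ^ 4)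
      =O[atImInfty] fun _ : ℍ => (1 : ℝ) ^ 4 := by
    have h' := h.mul (Asymptotics.isBigO_refl
      (fun τ : ℍ => ((denom γ τ) ^ (-((u + k / 2 : ℕ) : ℤ))) ^ 4) atImInfty)
    refine (h'.congr (fun τ => ?_) (g₂ := fun _ => (1 : ℂ)) (fun τ => ?_)).trans
      (Asymptotics.isBigO_of_le _ fun _ => by simp)
    · rw [ModularForm.SL_slash_apply, mixedTheta, mul_pow, mul_pow, Finset.prod_pow,
        Finset.prod_pow]
    · have hne := denom_ne_zero γ τ
      have hk2 : 2 * k = k / 2 * 4 := by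
        have := Nat.two_mul_div_two_of_even hk
        omega
      simp only [Finset.prod_const, Finset.card_univ, Fintype.card_fin]
      rw [zpow_neg, zpow_natCast, inv_pow, ← pow_mul, ← pow_mul, ← pow_mul, hk2, ← pow_add,
        show 4 * u + k / 2 * 4 = (u + k / 2) * 4 by ring, mul_inv_cancel₀ (pow_ne_zero _ hne)]
  exact Asymptotics.IsBigO.of_pow (n := 4) (by norm_num) hone

/-! ### The modular form -/

theorem exists_character (hk : Even k) (ha : ∀ i, 0 < a i) (hc : ∀ j, 0 < c j)
    (h8 : 8 ∣ ∑ j, c j) : ∃ χ : DirichletCharacter ℂ (level a c),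
      ∀ d : ℤ, IsCoprime d (level a c : ℤ) → χ (d : ZMod (level a c)) = (mixedChar u c d : ℂ) := by
  have : NeZero (level a c) := ⟨level_ne_zero ha hc⟩
  have hcop (x : (ZMod (level a c))ˣ) : IsCoprime ((x : ZMod (level a c)).val : ℤ) (level a c) :=
    Nat.isCoprime_iff_coprime.2 (ZMod.val_coe_unit_coprime x)
  let φ : (ZMod (level a c))ˣ →* ℂ :=
    { toFun := fun x => (mixedChar u c ((x : ZMod (level a c)).val : ℤ) : ℂ)
      map_one' := by
        rw [mixedChar_congr hk ha hc h8 (d := 1) isCoprime_one_left, mixedChar_one, Int.cast_one]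
        rw [← ZMod.intCast_eq_intCast_iff_dvd_sub]
        simp
      map_mul' := fun x y => by
        rw [← Int.cast_mul, ← mixedChar_mul (odd_of_isCoprime_level (hcop x))
          (odd_of_isCoprime_level (hcop y)),
          mixedChar_congr hk ha hc h8 ((hcop x).mul_left (hcop y))]
        rw [← ZMod.intCast_eq_intCast_iff_dvd_sub]
        simp }
  -- `φ` is defined through the representatives in $[0,L)$; `mixedChar_congr` makes it
  -- multiplicative and extends its values to all coprime $d$.
  refine ⟨MulChar.ofUnitHom φ.toHomUnits, fun d hd => ?_⟩
  obtain ⟨x, hx⟩ := (ZMod.coe_int_isUnit_iff_isCoprime d (level a c)).2 hd.symm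
  rw [← hx, MulChar.ofUnitHom_coe, MonoidHom.coe_toHomUnits]
  change (mixedChar u c ((x : ZMod (level a c)).val : ℤ) : ℂ) = _
  rw [mixedChar_congr hk ha hc h8 hd]
  rw [← ZMod.intCast_eq_intCast_iff_dvd_sub]
  simp [hx]

/-- The function `q^(h/8) ψ` as a modular form on `Γ₁(L)`. -/
def mixedModularForm (hk : Even k) (ha : ∀ i, 0 < a i) (hc : ∀ j, 0 < c j)
    (h8 : 8 ∣ ∑ j, c j) : ModularForm ((CongruenceSubgroup.Gamma1 (level a c)).map
      (Matrix.SpecialLinearGroup.mapGL ℝ)) ((u + k / 2 : ℕ) : ℤ) where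
  toFun τ := mixedTheta a c τ
  slash_action_eq' := by
    rintro _ ⟨γ, hγ, rfl⟩
    have h := mixedTheta_slash hk ha hc h8 (CongruenceSubgroup.Gamma1_in_Gamma0 _ hγ)
    have h1 : mixedChar u c (γ 1 1) = 1 := by
      refine (mixedChar_congr hk ha hc h8 isCoprime_one_left ?_).trans mixedChar_one
      rw [← ZMod.intCast_eq_intCast_iff_dvd_sub]
      simpa using ((CongruenceSubgroup.Gamma1_mem _ _).1 hγ).2.1.symm
    rw [h1, Int.cast_one, one_smul] at h
    exact h
  holo' := by
    refine UpperHalfPlane.mdifferentiable_iff.2 fun z hz => ?_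
    refine ((differentiableAt_mixedTheta ha hc hz).congr_of_eventuallyEq ?_).differentiableWithinAt
    filter_upwards [isOpen_im_pos.mem_nhds hz] with w hw
    change mixedTheta a c (ofComplex w) = _
    rw [ofComplex_apply_of_im_pos hw]
  bdd_at_cusps' := by
    intro x hx
    have : NeZero (level a c) := ⟨level_ne_zero ha hc⟩
    -- A cusp of $\Gamma_1(L)$ is a cusp of $SL_2(\mathbb Z)$, so bounding the slash by every
    -- $\gamma\in SL_2(\mathbb Z)$ is enough.
    have hx' : IsCusp x 𝒮ℒ := by
      refine hx.mono ?_
      rintro _ ⟨γ, -, rfl⟩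
      exact ⟨γ, rfl⟩
    rw [OnePoint.isBoundedAt_iff_forall_SL2Z hx']
    exact fun γ _ => isBoundedAtImInfty_mixedTheta_slash hk ha hc γ

end MixedForm

end

theorem theorem1p2 (u k : ℕ) (hk : Even k) (a : Fin u → ℕ) (c : Fin k → ℕ)
    (ha : ∀ i, 0 < a i) (hc : ∀ j, 0 < c j) (h8 : 8 ∣ ∑ j, c j) :
    (∀ τ : UpperHalfPlane,
      HasSum (fun n : ℕ => (MixedForm.repNum a c n : ℂ) *
          Complex.exp (2 * Real.pi * Complex.I * (τ : ℂ)) ^ n)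
        ((∏ i, MixedForm.calF (a i * (τ : ℂ))) * ∏ j, MixedForm.Psi (c j * (τ : ℂ)))) ∧
    ∃ χ' : DirichletCharacter ℂ (MixedForm.level a c),
      (∀ d : ℤ, IsCoprime d (MixedForm.level a c : ℤ) →
        χ' (d : ZMod (MixedForm.level a c)) =
          (((if Even u then 1 else legendreSym 3 d) *
            MixedForm.kroneckerSym ((-1) ^ (k / 2) * 4 * ∏ j, (c j : ℤ)) d : ℤ) : ℂ)) ∧
      ∃ f ∈ MixedForm.modularFormsWithChar (MixedForm.level a c) ((u + k / 2 : ℕ) : ℤ) χ',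
        ∀ τ : UpperHalfPlane,
          f τ = Complex.exp (2 * Real.pi * Complex.I * (τ : ℂ) * ((∑ j, c j : ℕ) : ℂ) / 8) *
            MixedForm.psiLT a c (τ : ℂ) := by
  refine ⟨fun τ => MixedForm.hasSum_repNum ha hc τ.im_pos, ?_⟩
  obtain ⟨χ, hχ⟩ := MixedForm.exists_character hk ha hc h8
  refine ⟨χ, hχ, MixedForm.mixedModularForm hk ha hc h8, fun γ hγ => ?_,
    fun τ => MixedForm.mixedTheta_eq ha hc τ.im_pos⟩
  rw [hχ _ (MixedForm.isCoprime_of_mem_Gamma0 hγ)]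
  exact MixedForm.mixedTheta_slash hk ha hc h8 hγ
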